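/- Let $\Bbbk$ be a field, let $n,t\ge 1$ be integers, let $q\in\Bbbk^*$ with $q^{2t}\neq 1$, and put $d=2t$. Let $\mathscr{H}_q^t$ be the $\Bbbk$-algebra generated by $\Omega,\Omega^{-1},\Psi,\Psi^{\dagger}$ subject to $\Omega\Omega^{-1}=\Omega^{-1}\Omega=1$, $\Psi\Omega=q\Omega\Psi$, $\Psi^{\dagger}\Omega=q^{-1}\Omega\Psi^{\dagger}$, $$\Psi\Psi^{\dagger}=\frac{q^t\Omega^t-q^{-t}\Omega^{-t}}{q^t-q^{-t}},\qquad \Psi^{\dagger}\Psi=\frac{\Omega^t-\Omega^{-t}}{q^t-q^{-t}}.$$ Let $A(d,q)=\Bbbk[h^{\pm1}](\sigma,h^d-1)$, with $\sigma(h)=qh$, be the generalized Weyl algebra: the extension of $\Bbbk[h^{\pm1}]$ by $x,y$ subject to $xy=\sigma(h^d-1)$, $yx=h^d-1$, $xr=\sigma(r)x$ and $yr=\sigma^{-1}(r)y$ for all $r\in\Bbbk[h^{\pm1}]$. Let $A=A(d,q)^{\otimes n}$ (tensor product over $\Bbbk$), with generators $h_i^{\pm1},x_i,y_i$ coming from the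 $i$-th factor. Let $\sigma_i$ be the automorphism of $\Bbbk[h_1^{\pm1},\ldots,h_n^{\pm1}]$ with $\sigma_i(h_i)=qh_i$ and $\sigma_i(h_j)=h_j$ for $j\ne i$. A $\Bbbk$-algebra automorphism of $A$ is called *qwa-tame* if it lies in the subgroup of $\mathrm{Aut}_{\Bbbk}(A)$ generated by the following automorphisms: - $\phi_g=g\otimes1\otimes\cdots\otimes1$ for $g\in\mathrm{Aut}_{\Bbbk}(A(d,q))$; - $\chi_w$ for each permutation $w$ of $\{1,\ldots,n\}$, where $\chi_w(h_i)=h_{w(i)}$, $\chi_w(x_i)=x_{w(i)}$, $\chi_w(y_i)=y_{w(i)}$; - $\xi_{\underline u}$ for each tuple $\underline u=(u_1,\ldots,u_n)$ of units of $A$ lying in $\Bbbk[h_1^{\pm1},\ldots,h_n^{\pm1}]$ with $u_i\sigma_i(u_l)=u_l\sigma_l(u_i)$ for all $l\neq i$, where $\xi_{\underline u}(h_i)=h_i$, $\xi_{\underline u}(x_i)=u_ix_i$, $\xi_{\underline u}(y_i)=y_iu_i^{-1}$. Then there is an isomorphism of $\Bbbk$-algebras $\Theta:(\mathscr{H}_q^t)^{\otimes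 n}\to A$ with $$\Theta(\Omega_i)=h_i,\qquad \Theta(\Psi_i)=x_i,\qquad \Theta(\Psi^{\dagger}_i)=(q^t-q^{-t})^{-1}h_i^{-t}y_i\qquad(1\le i\le n),$$ where $\Omega_i,\Psi_i,\Psi_i^\dagger$ denote the generators in the $i$-th tensor factor, and under this identification every $\Bbbk$-algebra automorphism of $\mathscr{H}_q^t\otimes\cdots\otimes\mathscr{H}_q^t$ is qwa-tame: $\Theta\psi\Theta^{-1}$ is qwa-tame for every $\psi\in\mathrm{Aut}_{\Bbbk}\big((\mathscr{H}_q^t)^{\otimes n}\big)$. -/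

import Mathlib

open scoped TensorProduct LaurentPolynomial

universe u

/-! ### Generalized Weyl algebras of degree one -/

section GeneralizedWeyl

variable {k R : Type u} [CommRing k] [CommRing R] [Algebra k R]

/-- Generators of a generalized Weyl algebra over `R`: the elements of `R`, and `x`, `y`. -/
inductive GWAGen (R : Type u) : Type u
  | coeff (r : R) : GWAGen R
  | x : GWAGen R
  | y : GWAGen R

/-- The relations of the generalized Weyl algebra `R(σ, a)`. The first three say that
`r ↦ coeff r` is a homomorphism of `k`-algebras; the other four are
`x y = σ(a)`, `y x = a`, `x r = σ(r) x` and `y r = σ⁻¹(r) y`. -/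
inductive GWARel (σ : R ≃ₐ[k] R) (a : R) :
    FreeAlgebra k (GWAGen R) → FreeAlgebra k (GWAGen R) → Prop
  | add (r s : R) : GWARel σ a
      (FreeAlgebra.ι k (GWAGen.coeff (r + s)))
      (FreeAlgebra.ι k (GWAGen.coeff r) + FreeAlgebra.ι k (GWAGen.coeff s))
  | mul (r s : R) : GWARel σ a
      (FreeAlgebra.ι k (GWAGen.coeff (r * s)))
      (FreeAlgebra.ι k (GWAGen.coeff r) * FreeAlgebra.ι k (GWAGen.coeff s))
  | scalar (c : k) : GWARel σ a
      (FreeAlgebra.ι k (GWAGen.coeff (algebraMap k R c)))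
      (algebraMap k (FreeAlgebra k (GWAGen R)) c)
  | x_y : GWARel σ a
      (FreeAlgebra.ι k GWAGen.x * FreeAlgebra.ι k GWAGen.y)
      (FreeAlgebra.ι k (GWAGen.coeff (σ a)))
  | y_x : GWARel σ a
      (FreeAlgebra.ι k GWAGen.y * FreeAlgebra.ι k GWAGen.x)
      (FreeAlgebra.ι k (GWAGen.coeff a))
  | x_coeff (r : R) : GWARel σ a
      (FreeAlgebra.ι k GWAGen.x * FreeAlgebra.ι k (GWAGen.coeff r))
      (FreeAlgebra.ι k (GWAGen.coeff (σ r)) * FreeAlgebra.ι k GWAGen.x)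
  | y_coeff (r : R) : GWARel σ a
      (FreeAlgebra.ι k GWAGen.y * FreeAlgebra.ι k (GWAGen.coeff r))
      (FreeAlgebra.ι k (GWAGen.coeff (σ.symm r)) * FreeAlgebra.ι k GWAGen.y)

/-- The generalized Weyl algebra `R(σ, a)` of degree one. -/
abbrev GWA (σ : R ≃ₐ[k] R) (a : R) : Type u := RingQuot (GWARel σ a)

namespace GWA

/-- The generator `x` of `R(σ, a)`. -/
noncomputable def x (σ : R ≃ₐ[k] R) (a : R) : GWA σ a :=
  RingQuot.mkAlgHom k (GWARel σ a) (FreeAlgebra.ι k GWAGen.x)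

/-- The generator `y` of `R(σ, a)`. -/
noncomputable def y (σ : R ≃ₐ[k] R) (a : R) : GWA σ a :=
  RingQuot.mkAlgHom k (GWARel σ a) (FreeAlgebra.ι k GWAGen.y)

/-- The structure homomorphism `R → R(σ, a)`. -/
noncomputable def coeff (σ : R ≃ₐ[k] R) (a : R) : R →ₐ[k] GWA σ a :=
  have hs (c : k) : RingQuot.mkAlgHom k (GWARel σ a)
      (FreeAlgebra.ι k (GWAGen.coeff (algebraMap k R c))) = algebraMap k _ c := by
    rw [RingQuot.mkAlgHom_rel k (GWARel.scalar c), AlgHom.commutes]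
  { toFun := fun r => RingQuot.mkAlgHom k (GWARel σ a) (FreeAlgebra.ι k (GWAGen.coeff r))
    map_one' := by simpa using hs 1
    map_zero' := by simpa using hs 0
    map_mul' := fun r s => by rw [RingQuot.mkAlgHom_rel k (GWARel.mul r s), map_mul]
    map_add' := fun r s => by rw [RingQuot.mkAlgHom_rel k (GWARel.add r s), map_add]
    commutes' := hs }

end GWA

end GeneralizedWeyl

/-! ### Diagonal automorphisms of group algebras -/

section Diagonal

variable {k : Type u} [CommRing k] {G : Type*} [AddCommGroup G]

/-- For a character `χ` of `G`, the endomorphism of the group algebra `k[G]` that multiplies the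
basis element of `m ∈ G` by `χ m`. -/
noncomputable def diagHom (χ : Multiplicative G →* kˣ) :
    AddMonoidAlgebra k G →ₐ[k] AddMonoidAlgebra k G :=
  AddMonoidAlgebra.lift k (AddMonoidAlgebra k G) G
    { toFun := fun m => AddMonoidAlgebra.single m.toAdd (χ m : k)
      map_one' := by simp [AddMonoidAlgebra.one_def]
      map_mul' := fun a b => by simp [AddMonoidAlgebra.single_mul_single] }

theorem diagHom_single (χ : Multiplicative G →* kˣ) (m : G) (c : k) :
    diagHom χ (AddMonoidAlgebra.single m c) =
      AddMonoidAlgebra.single m (c * (χ (Multiplicative.ofAdd m) : k)) := by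
  simp [diagHom, AddMonoidAlgebra.lift_single]

/-- The automorphism of `k[G]` that multiplies the basis element of `m ∈ G` by `χ m`. -/
noncomputable def diagAut (χ : Multiplicative G →* kˣ) :
    AddMonoidAlgebra k G ≃ₐ[k] AddMonoidAlgebra k G :=
  AlgEquiv.ofAlgHom (diagHom χ) (diagHom χ⁻¹)
    (by ext m; simp [diagHom_single])
    (by ext m; simp [diagHom_single])

end Diagonal

/-! ### Quantum Weyl analogue algebras -/

section QuantumWeylAnalogue

variable {k : Type u} [Field k]

/-- The automorphism `σ` of the Laurent polynomial ring `k[h, h⁻¹]` with `σ(h) = q h`. -/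
noncomputable def laurentScale (q : kˣ) : k[T;T⁻¹] ≃ₐ[k] k[T;T⁻¹] :=
  diagAut (zpowersHom kˣ q)

/-- The generalized Weyl algebra `A(d, q) = k[h, h⁻¹](σ, h ^ d - 1)` with `σ(h) = q h`. -/
abbrev QWeyl (d : ℕ) (q : kˣ) : Type u :=
  GWA (laurentScale q) (LaurentPolynomial.T (d : ℤ) - 1)

namespace QWeyl

/-- The structure homomorphism `k[h, h⁻¹] → A(d, q)`. -/
noncomputable def coeff (d : ℕ) (q : kˣ) : k[T;T⁻¹] →ₐ[k] QWeyl d q := GWA.coeff _ _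

/-- The power `h ^ m` in `A(d, q)`, for an integer `m`. -/
noncomputable def hPow (d : ℕ) (q : kˣ) (m : ℤ) : QWeyl d q :=
  coeff d q (LaurentPolynomial.T m)

/-- The generator `x` of `A(d, q)`. -/
noncomputable def x (d : ℕ) (q : kˣ) : QWeyl d q := GWA.x _ _

/-- The generator `y` of `A(d, q)`. -/
noncomputable def y (d : ℕ) (q : kˣ) : QWeyl d q := GWA.y _ _

end QWeyl

/-- The qwa algebra `A(n, d, (q, …, q))`: the tensor product over `k` of `n` copies
of `A(d, q)`. -/
abbrev QWA (n d : ℕ) (q : kˣ) : Type u := ⨂[k] _ : Fin n, QWeyl d q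

namespace QWA

variable (n d : ℕ) (q : kˣ)

/-- The element of `A(n, d, q)` with `a` in the `i`-th tensor factor and `1` elsewhere. -/
noncomputable def inFactor (i : Fin n) : QWeyl d q →ₐ[k] QWA n d q :=
  PiTensorProduct.singleAlgHom (R := k) (A := fun _ : Fin n => QWeyl d q) i

/-- The generator `h_i`. -/
noncomputable def h (i : Fin n) : QWA n d q := inFactor n d q i (QWeyl.hPow d q 1)

/-- The generator `x_i`. -/
noncomputable def x (i : Fin n) : QWA n d q := inFactor n d q i (QWeyl.x d q)

/-- The generator `y_i`. -/
noncomputable def y (i : Fin n) : QWA n d q := inFactor n d q i (QWeyl.y d q)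

/-- The structure homomorphism `k[h_1, h_1⁻¹, …, h_n, h_n⁻¹] → A(n, d, q)`, which maps the Laurent
monomial with exponent vector `m` to the tensor product of the `h ^ (m i)`. -/
noncomputable def coeff : AddMonoidAlgebra k (Fin n → ℤ) →ₐ[k] QWA n d q :=
  AddMonoidAlgebra.lift k (QWA n d q) (Fin n → ℤ)
    { toFun := fun m => PiTensorProduct.tprod k fun i => QWeyl.hPow d q (m.toAdd i)
      map_one' := by
        simp only [QWeyl.hPow, PiTensorProduct.one_def]
        congr 1
        funext i
        simp
      map_mul' := fun a b => by
        rw [PiTensorProduct.tprod_mul_tprod]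
        congr 1
        funext i
        simp only [QWeyl.hPow, toAdd_mul, Pi.add_apply, Pi.mul_apply,
          LaurentPolynomial.T_add, map_mul] }

/-- The automorphism `σ_i` of `k[h_1, h_1⁻¹, …, h_n, h_n⁻¹]` with `σ_i(h_i) = q h_i` and
`σ_i(h_j) = h_j` for `j ≠ i`. -/
noncomputable def scaleAt {n : ℕ} (q : kˣ) (i : Fin n) :
    AddMonoidAlgebra k (Fin n → ℤ) ≃ₐ[k] AddMonoidAlgebra k (Fin n → ℤ) :=
  diagAut ((zpowersHom kˣ q).comp (Pi.evalAddMonoidHom (fun _ : Fin n => ℤ) i).toMultiplicative)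

variable {n d q}

/-- `φ = g ⊗ 1 ⊗ ⋯ ⊗ 1` for an automorphism `g` of the first tensor factor. -/
def IsFactorAut [NeZero n] (φ : QWA n d q ≃ₐ[k] QWA n d q) : Prop :=
  ∃ g : QWeyl d q ≃ₐ[k] QWeyl d q, ∀ a : Fin n → QWeyl d q,
    φ (PiTensorProduct.tprod k a) = PiTensorProduct.tprod k (Function.update a 0 (g (a 0)))

/-- `χ` permutes the indices of the generators. -/
def IsPermAut (χ : QWA n d q ≃ₐ[k] QWA n d q) : Prop :=
  ∃ w : Equiv.Perm (Fin n), ∀ i,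
    χ (h n d q i) = h n d q (w i) ∧ χ (x n d q i) = x n d q (w i) ∧ χ (y n d q i) = y n d q (w i)

/-- `ξ(h_i) = h_i`, `ξ(x_i) = u_i x_i`, `ξ(y_i) = y_i u_i⁻¹` for units `u_i` of `A(n, d, q)` with
`u_i σ_i(u_l) = u_l σ_l(u_i)` for `l ≠ i`. The units are Laurent polynomials in the `h_j` (as are
all units of this algebra if `d > 0`), which is how `σ_i` applies to them. -/
def IsUnitAut (ξ : QWA n d q ≃ₐ[k] QWA n d q) : Prop :=
  ∃ (u : Fin n → (QWA n d q)ˣ) (p : Fin n → AddMonoidAlgebra k (Fin n → ℤ)),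
    (∀ i, (u i : QWA n d q) = coeff n d q (p i)) ∧
    (∀ i l, l ≠ i → p i * scaleAt q i (p l) = p l * scaleAt q l (p i)) ∧
    ∀ i, ξ (h n d q i) = h n d q i ∧
      ξ (x n d q i) = (u i : QWA n d q) * x n d q i ∧
      ξ (y n d q i) = y n d q i * ((u i)⁻¹ : (QWA n d q)ˣ)

/-- `ψ` is qwa-tame: it lies in the subgroup of the automorphism group generated by the three
families of automorphisms above. -/
def IsQwaTame [NeZero n] (ψ : QWA n d q ≃ₐ[k] QWA n d q) : Prop :=
  ψ ∈ Subgroup.closure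
    ({φ | IsFactorAut φ} ∪ {χ | IsPermAut χ} ∪ {ξ | IsUnitAut ξ} :
      Set (QWA n d q ≃ₐ[k] QWA n d q))

end QWA

end QuantumWeylAnalogue

/-! ### The generalized Weyl-Hayashi algebras -/

section WeylHayashi

variable {k : Type u} [Field k]

/-- The generators `Ω`, `Ω⁻¹`, `Ψ`, `Ψ†`. -/
inductive HayashiGen : Type
  | Ω : HayashiGen
  | Ωinv : HayashiGen
  | Ψ : HayashiGen
  | Ψdag : HayashiGen

open HayashiGen in
/-- The defining relations of the generalized Weyl-Hayashi algebra. -/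
inductive HayashiRel (t : ℕ) (q : kˣ) :
    FreeAlgebra k HayashiGen → FreeAlgebra k HayashiGen → Prop
  | Ω_Ωinv : HayashiRel t q (FreeAlgebra.ι k Ω * FreeAlgebra.ι k Ωinv) 1
  | Ωinv_Ω : HayashiRel t q (FreeAlgebra.ι k Ωinv * FreeAlgebra.ι k Ω) 1
  | Ψ_Ω : HayashiRel t q
      (FreeAlgebra.ι k Ψ * FreeAlgebra.ι k Ω)
      ((q : k) • (FreeAlgebra.ι k Ω * FreeAlgebra.ι k Ψ))
  | Ψdag_Ω : HayashiRel t q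
      (FreeAlgebra.ι k Ψdag * FreeAlgebra.ι k Ω)
      ((q : k)⁻¹ • (FreeAlgebra.ι k Ω * FreeAlgebra.ι k Ψdag))
  | Ψ_Ψdag : HayashiRel t q
      (FreeAlgebra.ι k Ψ * FreeAlgebra.ι k Ψdag)
      (((q : k) ^ t - ((q : k) ^ t)⁻¹)⁻¹ •
        ((q : k) ^ t • FreeAlgebra.ι k Ω ^ t - ((q : k) ^ t)⁻¹ • FreeAlgebra.ι k Ωinv ^ t))
  | Ψdag_Ψ : HayashiRel t q
      (FreeAlgebra.ι k Ψdag * FreeAlgebra.ι k Ψ)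
      (((q : k) ^ t - ((q : k) ^ t)⁻¹)⁻¹ • (FreeAlgebra.ι k Ω ^ t - FreeAlgebra.ι k Ωinv ^ t))

/-- The generalized Weyl-Hayashi algebra `H_q^t`. -/
abbrev Hayashi (t : ℕ) (q : kˣ) : Type u := RingQuot (HayashiRel t q)

/-- The image in `H_q^t` of a generator. -/
noncomputable def Hayashi.gen (t : ℕ) (q : kˣ) (g : HayashiGen) : Hayashi t q :=
  RingQuot.mkAlgHom k (HayashiRel t q) (FreeAlgebra.ι k g)

/-- The tensor product over `k` of `n` copies of `H_q^t`. -/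
abbrev HayashiPow (n t : ℕ) (q : kˣ) : Type u := ⨂[k] _ : Fin n, Hayashi t q

/-- The generator `g` in the `i`-th tensor factor of `H_q^t ⊗ ⋯ ⊗ H_q^t`. -/
noncomputable def HayashiPow.gen (n t : ℕ) (q : kˣ) (i : Fin n) (g : HayashiGen) :
    HayashiPow n t q :=
  PiTensorProduct.singleAlgHom (R := k) (A := fun _ : Fin n => Hayashi t q) i
    (Hayashi.gen t q g)

/-- The standard identification `Θ` of `H_q^t ⊗ ⋯ ⊗ H_q^t` with `A(n, 2t, q)`:
`Ω_i ↦ h_i`, `Ψ_i ↦ x_i`, `Ψ†_i ↦ (q ^ t - q ^ (-t))⁻¹ h_i ^ (-t) y_i`. -/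
def HayashiPow.IsStandardIso {n t : ℕ} {q : kˣ} (Θ : HayashiPow n t q ≃ₐ[k] QWA n (2 * t) q) :
    Prop :=
  ∀ i : Fin n,
    Θ (HayashiPow.gen n t q i HayashiGen.Ω) = QWA.h n (2 * t) q i ∧
    Θ (HayashiPow.gen n t q i HayashiGen.Ψ) = QWA.x n (2 * t) q i ∧
    Θ (HayashiPow.gen n t q i HayashiGen.Ψdag) =
      ((q : k) ^ t - ((q : k) ^ t)⁻¹)⁻¹ •
        (QWA.inFactor n (2 * t) q i (QWeyl.hPow (2 * t) q (-(t : ℤ))) * QWA.y n (2 * t) q i)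

end WeylHayashi

/-! ### Products with one homogeneous component -/

section HomogeneousFactors

/-! With `d = 2 * t`, the assignment `x = Ψ`, `y = (q ^ t - q ^ (-t)) Ω ^ t Ψ†` inverts the formula
for `Θ`; it is available because `q ^ (2 * t) ≠ 1`. The same hypothesis gives `q ^ 2 ≠ 1`, so it is
enough to prove that every automorphism `ψ` of `A` is tame when `d ≠ 0` and `q ^ 2 ≠ 1`
(`QWA.isQwaTame`).

The algebra `A` embeds in a quantum torus, the skew group ring of `ℤⁿ` over the Laurent polynomials
in the `h_i`, by `x_i ↦ X_i` and `y_i ↦ (h_i ^ d - 1) X_i⁻¹` (`embed_injective`). This gives a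
`ℤⁿ`-grading whose part of degree `β` is free of rank one over the Laurent polynomials, on a product
of powers of the `x_i` and `y_i`. Since `ℤⁿ` has two unique products and Laurent polynomials form a
domain, a product can be a nonzero homogeneous element only if both factors are homogeneous. This
has two consequences.

Units are scalar multiples of Laurent monomials: in a nonzero degree the product of opposite
generators vanishes at some `h_j = q ^ e`, so it cannot divide `1`. Hence `ψ` permutes the monomials
up to scalars, through an additive map `μ` of exponents.

The product `y_i x_i = h_i ^ d - 1` is mapped to a nonzero Laurent polynomial, so `ψ(x_i)` and
`ψ(y_i)` are homogeneous of opposite degrees. Specializing `h_j` to a power of `q` in `ψ(y_i) ψ(x_i)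
= ψ(h_i) ^ d - 1` then shows that `ψ(h_i)` is a scalar times a power of one `h_j`. Invertibility of
`ψ` makes the exponent and the degree of `ψ(x_i)` equal to `±1` in direction `j`, and `x_i h_i = q
h_i x_i` together with `q ^ 2 ≠ 1` makes the two signs agree (`exists_signed_index`).

The possible scalars are restricted to exactly those realized by automorphisms of a single factor. A
product `G` of a permutation and factor automorphisms therefore agrees with `ψ` on all `h_i`, and
`G⁻¹ ψ`, which fixes every `h_i`, is some `ξ_u` (`isUnitAut_of_map_h`). -/

theorem card_eq_one_of_uniqueMul_mem_singleton {G : Type*} [Mul G] [TwoUniqueProds G]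
    {A B : Finset G} {c : G} (hA : A.Nonempty) (hB : B.Nonempty)
    (h : ∀ a ∈ A, ∀ b ∈ B, UniqueMul A B a b → a * b = c) : A.card = 1 ∧ B.card = 1 := by
  -- Otherwise there are two distinct pairs with unique products; both products equal `c`, which
  -- contradicts uniqueness.
  have hle : ¬ 1 < A.card * B.card := by
    intro hlt
    obtain ⟨p₁, h₁, p₂, h₂, hne, hu₁, hu₂⟩ := TwoUniqueProds.uniqueMul_of_one_lt_card hlt
    rw [Finset.mem_product] at h₁ h₂
    have e₁ := h _ h₁.1 _ h₁.2 hu₁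
    have e₂ := h _ h₂.1 _ h₂.2 hu₂
    have := hu₁ h₂.1 h₂.2 (e₂.trans e₁.symm)
    exact hne (Prod.ext this.1.symm this.2.symm)
  have h1 : A.card * B.card = 1 :=
    le_antisymm (not_lt.1 hle) (Nat.mul_pos hA.card_pos hB.card_pos)
  exact ⟨Nat.eq_one_of_mul_eq_one_right h1, Nat.eq_one_of_mul_eq_one_left h1⟩

namespace SkewMonoidAlgebra

variable {R G : Type*}

theorem coeff_mul_of_uniqueMul [Semiring R] [Monoid G] [MulSemiringAction G R]
    (f g : SkewMonoidAlgebra R G) {a b : G} (h : UniqueMul f.support g.support a b) :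
    (f * g).coeff (a * b) = f.coeff a * a • g.coeff b := by
  classical
  simp_rw [coeff_mul, sum_def, Finsupp.sum, ← Finset.sum_product', support_coeff]
  refine (Finset.sum_eq_single (a, b) ?_ ?_).trans (if_pos rfl) <;> simp_rw [Finset.mem_product]
  · exact fun p hp hne => if_neg fun e =>
      hne (Prod.ext (h hp.1 hp.2 e).1 (h hp.1 hp.2 e).2)
  · intro hp
    refine ite_eq_right_iff.2 fun _ => ?_
    rcases not_and_or.1 hp with h0 | h0
    · rw [notMem_support_iff.1 h0, zero_mul]
    · rw [notMem_support_iff.1 h0, smul_zero, mul_zero]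

theorem eq_single_of_support_card_eq_one [Semiring R] {f : SkewMonoidAlgebra R G}
    (h : f.support.card = 1) : ∃ a r, f = single a r := by
  rw [← support_coeff] at h
  obtain ⟨a, r, hf⟩ := Finsupp.card_support_eq_one'.1 h
  exact ⟨a, r, coeff_injective hf.2⟩

/-- At a unique product `a * b` of the supports no cancellation occurs, so the coefficient of `f *
g` there is `f(a) * a • g(b)`, which is nonzero in a domain. Hence every unique product is `c`, and
both supports are singletons. -/
theorem eq_single_of_mul_eq_single [Semiring R] [NoZeroDivisors R] [Group G] [TwoUniqueProds G]
    [MulSemiringAction G R] {f g : SkewMonoidAlgebra R G} {c : G} {r : R} (hr : r ≠ 0)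
    (h : f * g = single c r) : (∃ a s, f = single a s) ∧ ∃ b s, g = single b s := by
  have hf : f ≠ 0 := by
    rintro rfl
    rw [zero_mul] at h
    exact hr (single_eq_zero.1 h.symm)
  have hg : g ≠ 0 := by
    rintro rfl
    rw [mul_zero] at h
    exact hr (single_eq_zero.1 h.symm)
  have hA : f.support.Nonempty := Finset.nonempty_iff_ne_empty.2 (mt support_eq_empty.1 hf)
  have hB : g.support.Nonempty := Finset.nonempty_iff_ne_empty.2 (mt support_eq_empty.1 hg)
  have key := card_eq_one_of_uniqueMul_mem_singleton (c := c) hA hB fun a ha b hb hu => by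
    by_contra hne
    have := coeff_mul_of_uniqueMul f g hu
    classical
    rw [h, coeff_single_apply, if_neg (Ne.symm hne)] at this
    rcases mul_eq_zero.1 this.symm with h0 | h0
    · exact mem_support_iff.1 ha h0
    · exact mem_support_iff.1 hb ((smul_eq_zero_iff_eq a).1 h0)
  exact ⟨eq_single_of_support_card_eq_one key.1, eq_single_of_support_card_eq_one key.2⟩

end SkewMonoidAlgebra

theorem AddMonoidAlgebra.eq_single_of_mul_eq_one {K M : Type*} [Field K] [AddCommGroup M]
    [TwoUniqueSums M] {f g : AddMonoidAlgebra K M} (h : f * g = 1) :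
    ∃ m c, c ≠ 0 ∧ f = AddMonoidAlgebra.single m c := by
  have hf : f ≠ 0 := left_ne_zero_of_mul_eq_one h
  have hg : g ≠ 0 := right_ne_zero_of_mul_eq_one h
  have hA : f.coeff.support.Nonempty := Finsupp.support_nonempty_iff.2 (mt coeff_eq_zero.1 hf)
  have hB : g.coeff.support.Nonempty := Finsupp.support_nonempty_iff.2 (mt coeff_eq_zero.1 hg)
  have key := card_eq_one_of_uniqueMul_mem_singleton (G := Multiplicative M) (c := 1) hA hB
    fun a ha b hb hu => by
      by_contra hne
      have := coeff_mul_add_of_uniqueAdd (f := f) (g := g) (a0 := a.toAdd) (b0 := b.toAdd) hu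
      rw [h, one_def, coeff_single, Finsupp.single_eq_of_ne
        (show a.toAdd + b.toAdd ≠ 0 from hne)] at this
      rcases mul_eq_zero.1 this.symm with h0 | h0
      · exact Finsupp.mem_support_iff.1 ha h0
      · exact Finsupp.mem_support_iff.1 hb h0
  obtain ⟨m, c, hc, hf⟩ := Finsupp.card_support_eq_one'.1 key.1
  exact ⟨m, c, hc, coeff_injective hf⟩

end HomogeneousFactors

/-! ### Universal properties -/

namespace GWA

variable {k R : Type u} [CommRing k] [CommRing R] [Algebra k R] (σ : R ≃ₐ[k] R) (a : R)

theorem x_mul_y : x σ a * y σ a = coeff σ a (σ a) := by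
  simpa [x, y, coeff] using RingQuot.mkAlgHom_rel k (GWARel.x_y (σ := σ) (a := a))

theorem y_mul_x : y σ a * x σ a = coeff σ a a := by
  simpa [x, y, coeff] using RingQuot.mkAlgHom_rel k (GWARel.y_x (σ := σ) (a := a))

theorem x_mul_coeff (r : R) : x σ a * coeff σ a r = coeff σ a (σ r) * x σ a := by
  simpa [x, y, coeff] using RingQuot.mkAlgHom_rel k (GWARel.x_coeff (σ := σ) (a := a) r)

theorem y_mul_coeff (r : R) : y σ a * coeff σ a r = coeff σ a (σ.symm r) * y σ a := by
  simpa [x, y, coeff] using RingQuot.mkAlgHom_rel k (GWARel.y_coeff (σ := σ) (a := a) r)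

section Lift

variable {σ a} {B : Type*} [Ring B] [Algebra k B]

/-- The homomorphism from `R(σ, a)` given by a homomorphism from `R` and images of `x` and `y`
that satisfy the relations. -/
noncomputable def lift (f : R →ₐ[k] B) (X Y : B) (hXY : X * Y = f (σ a)) (hYX : Y * X = f a)
    (hX : ∀ r, X * f r = f (σ r) * X) (hY : ∀ r, Y * f r = f (σ.symm r) * Y) : GWA σ a →ₐ[k] B :=
  RingQuot.liftAlgHom k
    ⟨FreeAlgebra.lift k fun g => match g with
      | GWAGen.coeff r => f r
      | GWAGen.x => X
      | GWAGen.y => Y, by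
      intro u v h
      cases h <;> simp [hXY, hYX, hX, hY]⟩

variable (f : R →ₐ[k] B) (X Y : B) (hXY : X * Y = f (σ a)) (hYX : Y * X = f a)
    (hX : ∀ r, X * f r = f (σ r) * X) (hY : ∀ r, Y * f r = f (σ.symm r) * Y)

@[simp] theorem lift_coeff (r : R) : lift f X Y hXY hYX hX hY (coeff σ a r) = f r := by
  simp [lift, coeff]

@[simp] theorem lift_x : lift f X Y hXY hYX hX hY (x σ a) = X := by
  simp [lift, x]

@[simp] theorem lift_y : lift f X Y hXY hYX hX hY (y σ a) = Y := by
  simp [lift, y]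

end Lift

variable {σ a}

theorem algHom_ext {B : Type*} [Ring B] [Algebra k B] {f g : GWA σ a →ₐ[k] B}
    (hc : ∀ r, f (coeff σ a r) = g (coeff σ a r)) (hx : f (x σ a) = g (x σ a))
    (hy : f (y σ a) = g (y σ a)) : f = g := by
  apply RingQuot.ringQuot_ext'
  apply FreeAlgebra.hom_ext
  funext w
  cases w with
  | coeff r => exact hc r
  | x => exact hx
  | y => exact hy

/-- A subalgebra that contains the coefficients, `x` and `y` is everything. -/
theorem mem_of_generators (S : Subalgebra k (GWA σ a)) (hc : ∀ r, coeff σ a r ∈ S)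
    (hx : x σ a ∈ S) (hy : y σ a ∈ S) (z : GWA σ a) : z ∈ S := by
  obtain ⟨w, rfl⟩ := RingQuot.mkAlgHom_surjective k (GWARel σ a) z
  induction w using FreeAlgebra.induction with
  | grade0 c => rw [AlgHom.commutes]; exact S.algebraMap_mem c
  | grade1 w =>
    cases w with
    | coeff r => exact hc r
    | x => exact hx
    | y => exact hy
  | mul u v hu hv => rw [map_mul]; exact S.mul_mem hu hv
  | add u v hu hv => rw [map_add]; exact S.add_mem hu hv

end GWA

/-! ### Algebra homomorphisms between tensor products -/

namespace PiTensorProduct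

variable {k ι : Type*} [CommRing k]
variable {A B : ι → Type*} [∀ i, Ring (A i)] [∀ i, Algebra k (A i)]
  [∀ i, Ring (B i)] [∀ i, Algebra k (B i)]

/-- The tensor product of algebra homomorphisms. -/
noncomputable def mapAlgHom (f : ∀ i, A i →ₐ[k] B i) : (⨂[k] i, A i) →ₐ[k] ⨂[k] i, B i :=
  liftAlgHom ((tprod k).compLinearMap fun i => (f i).toLinearMap)
    (by simp [one_def, Pi.one_def]) (fun a b => by simp [tprod_mul_tprod, Pi.mul_def])

@[simp] theorem mapAlgHom_tprod (f : ∀ i, A i →ₐ[k] B i) (a : ∀ i, A i) :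
    mapAlgHom f (tprod k a) = tprod k fun i => f i (a i) := by
  simp [mapAlgHom]

theorem algHom_ext_tprod {S : Type*} [Semiring S] [Algebra k S] {f g : (⨂[k] i, A i) →ₐ[k] S}
    (h : ∀ a, f (tprod k a) = g (tprod k a)) : f = g :=
  AlgHom.toLinearMap_injective (PiTensorProduct.ext (MultilinearMap.ext h))

/-- The tensor product of algebra isomorphisms. -/
noncomputable def mapAlgEquiv (f : ∀ i, A i ≃ₐ[k] B i) : (⨂[k] i, A i) ≃ₐ[k] ⨂[k] i, B i :=
  AlgEquiv.ofAlgHom (mapAlgHom fun i => (f i : A i →ₐ[k] B i))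
    (mapAlgHom fun i => ((f i).symm : B i →ₐ[k] A i))
    (algHom_ext_tprod fun a => by simp) (algHom_ext_tprod fun a => by simp)

@[simp] theorem mapAlgEquiv_tprod (f : ∀ i, A i ≃ₐ[k] B i) (a : ∀ i, A i) :
    mapAlgEquiv f (tprod k a) = tprod k fun i => f i (a i) :=
  mapAlgHom_tprod _ a

variable {C : Type*} [Ring C] [Algebra k C]


/-- The homomorphism that permutes the factors of a tensor power of an algebra. -/
noncomputable def permAlgHom (w : Equiv.Perm ι) : (⨂[k] _ : ι, C) →ₐ[k] ⨂[k] _ : ι, C :=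
  liftAlgHom ((tprod k (s := fun _ : ι => C)).domDomCongr w.symm) rfl
    (fun a b => by simp [tprod_mul_tprod, Pi.mul_def])

@[simp] theorem permAlgHom_tprod (w : Equiv.Perm ι) (a : ι → C) :
    permAlgHom w (tprod k a) = tprod k fun i => a (w.symm i) :=
  lift.tprod _

/-- The automorphism that permutes the factors of a tensor power of an algebra. -/
noncomputable def permAlgEquiv (w : Equiv.Perm ι) : (⨂[k] _ : ι, C) ≃ₐ[k] ⨂[k] _ : ι, C :=
  AlgEquiv.ofAlgHom (permAlgHom w) (permAlgHom w.symm)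
    (algHom_ext_tprod fun a => by simp) (algHom_ext_tprod fun a => by simp)

@[simp] theorem permAlgEquiv_tprod (w : Equiv.Perm ι) (a : ι → C) :
    permAlgEquiv w (tprod k a) = tprod k fun i => a (w.symm i) :=
  permAlgHom_tprod w a

variable [DecidableEq ι]

theorem singleAlgHom_eq_tprod (i : ι) (a : A i) :
    singleAlgHom (R := k) i a = tprod k (Pi.mulSingle i a) := rfl

@[simp] theorem mapAlgEquiv_singleAlgHom (f : ∀ i, A i ≃ₐ[k] B i) (i : ι) (a : A i) :
    mapAlgEquiv f (singleAlgHom (R := k) i a) = singleAlgHom (R := k) i (f i a) := by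
  rw [singleAlgHom_eq_tprod, singleAlgHom_eq_tprod, mapAlgEquiv_tprod]
  congr 1
  funext j
  rcases eq_or_ne j i with rfl | hj
  · simp
  · simp [hj]

@[simp] theorem permAlgEquiv_singleAlgHom (w : Equiv.Perm ι) (i : ι) (a : C) :
    permAlgEquiv w (singleAlgHom (R := k) (A := fun _ : ι => C) i a) =
      singleAlgHom (R := k) (A := fun _ : ι => C) (w i) a := by
  rw [singleAlgHom_eq_tprod, singleAlgHom_eq_tprod, permAlgEquiv_tprod]
  congr 1
  funext j
  by_cases hj : w.symm j = i
  · have : j = w i := by rw [← hj]; simp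
    subst this
    simp
  · have : j ≠ w i := fun e => hj (by rw [e]; simp)
    rw [Pi.mulSingle_eq_of_ne hj, Pi.mulSingle_eq_of_ne this]

section Commuting

variable [Fintype ι] {S : Type*} [Ring S] [Algebra k S] (f : ∀ i, A i →ₐ[k] S)
  (hf : Pairwise fun i j => ∀ a b, Commute (f i a) (f j b))

/-- The homomorphism from a tensor product of algebras given by homomorphisms from the factors with
commuting images. -/
noncomputable def liftCommuting : (⨂[k] i, A i) →ₐ[k] S :=
  let F : (∀ i, A i) →* S :=
    MonoidHom.noncommPiCoprod (fun i => ((f i : A i →ₐ[k] S) : A i →* S)) hf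
  -- Isolating the `i`-th entry as a right factor makes the product linear in that entry.
  have hF [DecidableEq ι] (a : ∀ i, A i) (i : ι) (x : A i) :
      F (Function.update a i x) = F (Function.update a i 1) * f i x := by
    have : Function.update a i x = Function.update a i 1 * Pi.mulSingle i x := by
      funext j
      rcases eq_or_ne j i with rfl | hj
      · simp
      · simp [hj]
    rw [this, map_mul]
    congr 1
    exact MonoidHom.noncommPiCoprod_mulSingle (fun i => ((f i : A i →ₐ[k] S) : A i →* S)) i _
  liftAlgHom
    { toFun := F
      map_update_add' := fun {_} a i x y => by
        rw [hF, hF a i x, hF a i y, map_add, mul_add]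
      map_update_smul' := fun {_} a i c x => by
        rw [hF, hF a i x, map_smul, mul_smul_comm] }
    (map_one F) (map_mul F)

@[simp] theorem liftCommuting_singleAlgHom (i : ι) (a : A i) :
    liftCommuting f hf (singleAlgHom (R := k) i a) = f i a := by
  rw [singleAlgHom_eq_tprod]
  simp only [liftCommuting, liftAlgHom_apply, lift.tprod]
  exact MonoidHom.noncommPiCoprod_mulSingle (hcomm := hf)
    (fun i => ((f i : A i →ₐ[k] S) : A i →* S)) i _

omit [DecidableEq ι] in
theorem liftCommuting_tprod (a : ∀ i, A i)
    (ha : ((Finset.univ : Finset ι) : Set ι).Pairwise (Function.onFun Commute fun i => f i (a i))) :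
    liftCommuting f hf (tprod k a) = Finset.univ.noncommProd (fun i => f i (a i)) ha := by
  simp only [liftCommuting, liftAlgHom_apply, lift.tprod]
  rfl

end Commuting

theorem commute_singleAlgHom {i j : ι} (h : i ≠ j) (a : A i) (b : A j) :
    Commute (singleAlgHom (R := k) i a : ⨂[k] i, A i) (singleAlgHom (R := k) j b) := by
  rw [singleAlgHom_eq_tprod, singleAlgHom_eq_tprod]
  exact Commute.tprod (Pi.mulSingle_commute h a b)

variable [Fintype ι]

omit [Fintype ι] in
theorem pairwise_commute_singleAlgHom (s : Set ι) (a : ∀ i, A i) :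
    s.Pairwise (Function.onFun Commute
      fun i => (singleAlgHom (R := k) i (a i) : ⨂[k] i, A i)) :=
  fun _ _ _ _ h => commute_singleAlgHom h _ _

/-- The homomorphism that `liftCommuting` builds from the factor inclusions is the identity, since
it agrees with the identity on each factor. -/
theorem tprod_eq_noncommProd (a : ∀ i, A i) :
    tprod k a = Finset.univ.noncommProd
      (fun i => (singleAlgHom (R := k) i (a i) : ⨂[k] i, A i))
      (pairwise_commute_singleAlgHom _ a) := by
  refine Eq.trans ?_ (liftCommuting_tprod (fun i => singleAlgHom (R := k) (A := A) i)
    (fun _ _ h => commute_singleAlgHom h) a _)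
  have : liftCommuting (fun i => singleAlgHom (R := k) (A := A) i)
      (fun _ _ h => commute_singleAlgHom h) = AlgHom.id k _ :=
    PiTensorProduct.algHom_ext fun i => AlgHom.ext fun b =>
      liftCommuting_singleAlgHom (fun i => singleAlgHom (R := k) (A := A) i) _ i b
  rw [this, AlgHom.id_apply]

/-- A submodule that contains `1` and is stable under left multiplication by the elements of the
tensor factors is everything. -/
theorem mem_of_left_mul_mem (S : Submodule k (⨂[k] i, A i)) (h1 : 1 ∈ S)
    (h : ∀ i a, ∀ z ∈ S, singleAlgHom (R := k) i a * z ∈ S) (z : ⨂[k] i, A i) : z ∈ S := by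
  have hz : z ∈ Submodule.span k (Set.range (tprod k)) := by
    rw [span_tprod_eq_top]; trivial
  refine Submodule.span_le.2 ?_ hz
  rintro _ ⟨a, rfl⟩
  let P : (⨂[k] i, A i) → Prop := fun w => ∀ z ∈ S, w * z ∈ S
  have : P (tprod k a) := by
    rw [tprod_eq_noncommProd]
    refine Finset.noncommProd_induction _ _ _ P ?_ ?_ ?_
    · intro u v hu hv z hz
      rw [mul_assoc]
      exact hu _ (hv z hz)
    · intro z hz
      rwa [one_mul]
    · intro i _
      exact h i (a i)
  simpa using this 1 h1

end PiTensorProduct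
section QuantumWeylAnalogue

variable {k : Type u} [Field k]

/-! ### Shifts of Laurent polynomials -/

theorem AddMonoidAlgebra.algHom_congr {G B : Type*} [AddMonoid G] [Semiring B] [Algebra k B]
    (f g : AddMonoidAlgebra k G →ₐ[k] B)
    (h : ∀ m, f (AddMonoidAlgebra.single m 1) = g (AddMonoidAlgebra.single m 1))
    (r : AddMonoidAlgebra k G) : f r = g r := by
  induction r using AddMonoidAlgebra.induction_linear with
  | zero => rw [map_zero, map_zero]
  | add r s hr hs => rw [map_add, map_add, hr, hs]
  | single m c =>
    rw [← mul_one c, ← smul_eq_mul, ← AddMonoidAlgebra.smul_single, map_smul, map_smul, h]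

theorem diagAut_single {G : Type*} [AddCommGroup G] (χ : Multiplicative G →* kˣ) (m : G) (c : k) :
    diagAut χ (AddMonoidAlgebra.single m c) =
      AddMonoidAlgebra.single m (c * (χ (Multiplicative.ofAdd m) : k)) :=
  diagHom_single χ m c

theorem diagAut_symm_single {G : Type*} [AddCommGroup G] (χ : Multiplicative G →* kˣ) (m : G)
    (c : k) : (diagAut χ).symm (AddMonoidAlgebra.single m c) =
      AddMonoidAlgebra.single m (c * ((χ (Multiplicative.ofAdd m))⁻¹ : kˣ)) :=
  diagHom_single χ⁻¹ m c

theorem laurentScale_single (q : kˣ) (m : ℤ) (c : k) :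
    laurentScale q (AddMonoidAlgebra.single m c) =
      AddMonoidAlgebra.single m (c * ((q ^ m : kˣ) : k)) :=
  (diagAut_single _ _ _).trans (by rw [zpowersHom_apply, toAdd_ofAdd])

theorem laurentScale_T (q : kˣ) (m : ℤ) :
    laurentScale q (LaurentPolynomial.T m) = ((q ^ m : kˣ) : k) • (LaurentPolynomial.T m) := by
  rw [LaurentPolynomial.T, laurentScale_single, AddMonoidAlgebra.smul_single, smul_eq_mul, mul_comm]

theorem laurentScale_symm (q : kˣ) : (laurentScale q).symm = laurentScale q⁻¹ := by
  refine AlgEquiv.ext (AddMonoidAlgebra.algHom_congr (laurentScale q).symm.toAlgHom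
    (laurentScale q⁻¹).toAlgHom fun m => ?_)
  refine (diagAut_symm_single _ _ _).trans (Eq.trans ?_ (laurentScale_single q⁻¹ m 1).symm)
  rw [zpowersHom_apply, toAdd_ofAdd, inv_zpow]

theorem laurentScale_mul (q q' : kˣ) (r : k[T;T⁻¹]) :
    laurentScale (q * q') r = laurentScale q (laurentScale q' r) := by
  refine AddMonoidAlgebra.algHom_congr (laurentScale (q * q')).toAlgHom
    ((laurentScale q).toAlgHom.comp (laurentScale q').toAlgHom) (fun m => ?_) r
  simp only [AlgEquiv.toAlgHom_apply, AlgHom.comp_apply, laurentScale_single, mul_zpow,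
    Units.val_mul]
  rw [one_mul, one_mul, mul_comm]

theorem laurentScale_one (r : k[T;T⁻¹]) : laurentScale (1 : kˣ) r = r := by
  refine AddMonoidAlgebra.algHom_congr (laurentScale (1 : kˣ)).toAlgHom (AlgHom.id k _)
    (fun m => ?_) r
  simp only [AlgEquiv.toAlgHom_apply, AlgHom.id_apply, laurentScale_single, one_zpow, Units.val_one,
    mul_one]

/-! ### Homogeneous generators of one tensor factor. -/

namespace QWeyl

variable (d : ℕ) (q : kˣ)

theorem x_mul_y : x d q * y d q = coeff d q (laurentScale q (LaurentPolynomial.T (d : ℤ) - 1)) :=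
  GWA.x_mul_y _ _

theorem y_mul_x : y d q * x d q = coeff d q (LaurentPolynomial.T (d : ℤ) - 1) :=
  GWA.y_mul_x _ _

theorem x_mul_coeff (r : k[T;T⁻¹]) :
    x d q * coeff d q r = coeff d q (laurentScale q r) * x d q :=
  GWA.x_mul_coeff _ _ r

theorem y_mul_coeff (r : k[T;T⁻¹]) :
    y d q * coeff d q r = coeff d q (laurentScale q⁻¹ r) * y d q := by
  rw [← laurentScale_symm]
  exact GWA.y_mul_coeff _ _ r

/-- The homogeneous generators: `x ^ m` for `m ≥ 0` and `y ^ (-m)` for `m < 0`. -/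
noncomputable def xPow : ℤ → QWeyl d q
  | Int.ofNat m => x d q ^ m
  | Int.negSucc m => y d q ^ (m + 1)

theorem xPow_natCast (m : ℕ) : xPow d q m = x d q ^ m := rfl

theorem xPow_neg_natCast (m : ℕ) : xPow d q (-(m : ℤ)) = y d q ^ m := by
  cases m with
  | zero =>
    rw [Nat.cast_zero, neg_zero, pow_zero]
    exact pow_zero _
  | succ m => rfl

@[simp] theorem xPow_zero : xPow d q 0 = 1 := by
  simpa using xPow_natCast d q 0

@[simp] theorem xPow_one : xPow d q 1 = x d q := by
  simpa using xPow_natCast d q 1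

@[simp] theorem xPow_neg_one : xPow d q (-1) = y d q := by
  simpa using xPow_neg_natCast d q 1

theorem x_pow_mul_coeff (m : ℕ) (r : k[T;T⁻¹]) :
    x d q ^ m * coeff d q r = coeff d q (laurentScale (q ^ m) r) * x d q ^ m := by
  induction m with
  | zero => simp [laurentScale_one]
  | succ m ih =>
    rw [pow_succ', mul_assoc, ih, ← mul_assoc, x_mul_coeff, mul_assoc, ← laurentScale_mul,
      ← pow_succ']

theorem y_pow_mul_coeff (m : ℕ) (r : k[T;T⁻¹]) :
    y d q ^ m * coeff d q r = coeff d q (laurentScale (q⁻¹ ^ m) r) * y d q ^ m := by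
  induction m with
  | zero => simp [laurentScale_one]
  | succ m ih =>
    rw [pow_succ', mul_assoc, ih, ← mul_assoc, y_mul_coeff, mul_assoc, ← laurentScale_mul,
      ← pow_succ']

theorem xPow_mul_coeff (m : ℤ) (r : k[T;T⁻¹]) :
    xPow d q m * coeff d q r = coeff d q (laurentScale (q ^ m) r) * xPow d q m := by
  obtain ⟨m, rfl | rfl⟩ := m.eq_nat_or_neg
  · rw [xPow_natCast, x_pow_mul_coeff, zpow_natCast]
  · rw [xPow_neg_natCast, y_pow_mul_coeff, zpow_neg, zpow_natCast, inv_pow]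

theorem x_mul_xPow (m : ℤ) : ∃ c, x d q * xPow d q m = coeff d q c * xPow d q (m + 1) := by
  cases m with
  | ofNat m =>
    refine ⟨1, ?_⟩
    rw [map_one, one_mul]
    exact (pow_succ' _ _).symm
  | negSucc m =>
    refine ⟨laurentScale q (LaurentPolynomial.T (d : ℤ) - 1), ?_⟩
    rw [show Int.negSucc m + 1 = -(m : ℤ) by omega, xPow_neg_natCast,
      show xPow d q (Int.negSucc m) = y d q ^ (m + 1) from rfl, pow_succ', ← mul_assoc, x_mul_y]

theorem y_mul_xPow (m : ℤ) : ∃ c, y d q * xPow d q m = coeff d q c * xPow d q (m - 1) := by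
  obtain ⟨m, rfl | rfl⟩ := m.eq_nat_or_neg
  · cases m with
    | zero => exact ⟨1, by simp⟩
    | succ m =>
      refine ⟨LaurentPolynomial.T (d : ℤ) - 1, ?_⟩
      rw [show ((m + 1 : ℕ) : ℤ) - 1 = m by omega, xPow_natCast, xPow_natCast, pow_succ',
        ← mul_assoc, y_mul_x]
  · refine ⟨1, ?_⟩
    rw [show -(m : ℤ) - 1 = -((m + 1 : ℕ) : ℤ) by omega, xPow_neg_natCast, xPow_neg_natCast,
      map_one, one_mul, pow_succ']

theorem xPow_mul_xPow (a b : ℤ) :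
    ∃ c, xPow d q a * xPow d q b = coeff d q c * xPow d q (a + b) := by
  obtain ⟨a, rfl | rfl⟩ := a.eq_nat_or_neg
  · induction a with
    | zero => exact ⟨1, by simp⟩
    | succ a ih =>
      obtain ⟨c, hc⟩ := ih
      obtain ⟨c', hc'⟩ := x_mul_xPow d q (a + b)
      refine ⟨laurentScale q c * c', ?_⟩
      rw [xPow_natCast] at hc ⊢
      rw [pow_succ', mul_assoc, hc, ← mul_assoc, x_mul_coeff, mul_assoc, hc', ← mul_assoc, map_mul]
      congr 2
      push_cast
      ring
  · induction a with
    | zero => exact ⟨1, by simp⟩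
    | succ a ih =>
      obtain ⟨c, hc⟩ := ih
      obtain ⟨c', hc'⟩ := y_mul_xPow d q (-a + b)
      refine ⟨laurentScale q⁻¹ c * c', ?_⟩
      rw [xPow_neg_natCast] at hc ⊢
      rw [pow_succ', mul_assoc, hc, ← mul_assoc, y_mul_coeff, mul_assoc, hc', ← mul_assoc, map_mul]
      congr 2
      push_cast
      ring

/-- The product of opposite homogeneous generators is divisible by a shift of `h ^ d - 1`. -/
theorem xPow_mul_xPow_neg (m : ℤ) :
    ∃ c, xPow d q m * xPow d q (-m) = coeff d q c ∧
      (m ≠ 0 → ∃ e : ℤ, laurentScale (q ^ e) (LaurentPolynomial.T (d : ℤ) - 1) ∣ c) := by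
  obtain ⟨m, rfl | rfl⟩ := m.eq_nat_or_neg
  · rw [xPow_neg_natCast, xPow_natCast]
    induction m with
    | zero => exact ⟨1, by simp⟩
    | succ m ih =>
      obtain ⟨c, hc, -⟩ := ih
      refine ⟨_, ?_, fun _ => ⟨(m + 1 : ℕ), c, rfl⟩⟩
      -- The innermost `x y = σ(h ^ d - 1)` is moved left past `x ^ m`, which shifts it to `σ ^ (m +
      -- 1)`. In the negative case the innermost `y x = h ^ d - 1` becomes `σ ^ (-m)` of itself.
      rw [pow_succ, pow_succ', mul_assoc, ← mul_assoc (x d q) (y d q), x_mul_y, ← mul_assoc,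
        x_pow_mul_coeff, mul_assoc, hc, ← laurentScale_mul, ← pow_succ, map_mul, zpow_natCast]
  · rw [neg_neg, xPow_neg_natCast, xPow_natCast]
    induction m with
    | zero => exact ⟨1, by simp⟩
    | succ m ih =>
      obtain ⟨c, hc, -⟩ := ih
      refine ⟨_, ?_, fun _ => ⟨-(m : ℤ), c, rfl⟩⟩
      rw [pow_succ, pow_succ', mul_assoc, ← mul_assoc (y d q) (x d q), y_mul_x, ← mul_assoc,
        y_pow_mul_coeff, mul_assoc, hc, map_mul, zpow_neg, zpow_natCast, inv_pow]

end QWeyl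

/-! ### Shifts and specializations of Laurent polynomials in several variables. -/

namespace QWA

variable {n : ℕ}

/-- The pairing of exponent vectors as a character with values in the powers of `q`. -/
noncomputable def shiftChar (q : kˣ) (β : Fin n → ℤ) : Multiplicative (Fin n → ℤ) →* kˣ :=
  (zpowersHom kˣ q).comp (AddMonoidHom.toMultiplicative
    (AddMonoidHom.mk' (fun α => β ⬝ᵥ α) (dotProduct_add β)))

/-- The automorphism `σ₁ ^ β₁ ⋯ σₙ ^ βₙ` of `k[h_1, h_1⁻¹, …, h_n, h_n⁻¹]`. -/
noncomputable def shift (q : kˣ) (β : Fin n → ℤ) :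
    AddMonoidAlgebra k (Fin n → ℤ) ≃ₐ[k] AddMonoidAlgebra k (Fin n → ℤ) :=
  diagAut (shiftChar q β)

theorem shift_single (q : kˣ) (β α : Fin n → ℤ) (c : k) :
    shift q β (AddMonoidAlgebra.single α c) =
      AddMonoidAlgebra.single α (c * ((q ^ (β ⬝ᵥ α) : kˣ) : k)) :=
  diagAut_single _ _ _

theorem shift_add (q : kˣ) (β γ : Fin n → ℤ) (r : AddMonoidAlgebra k (Fin n → ℤ)) :
    shift q (β + γ) r = shift q β (shift q γ r) := by
  refine AddMonoidAlgebra.algHom_congr (shift q (β + γ)).toAlgHom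
    ((shift q β).toAlgHom.comp (shift q γ).toAlgHom) (fun m => ?_) r
  simp [shift_single, add_dotProduct, zpow_add, mul_comm]

theorem shift_zero (q : kˣ) (r : AddMonoidAlgebra k (Fin n → ℤ)) :
    shift q 0 r = r := by
  refine AddMonoidAlgebra.algHom_congr (shift q 0).toAlgHom (AlgHom.id k _)
    (fun m => ?_) r
  simp [shift_single]

theorem scaleAt_eq_shift (q : kˣ) (i : Fin n) :
    scaleAt q i = shift q (Pi.single i 1) := by
  refine AlgEquiv.ext (AddMonoidAlgebra.algHom_congr (scaleAt q i).toAlgHom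
    (shift q (Pi.single i 1)).toAlgHom fun m => ?_)
  simp [scaleAt, diagAut_single, shift_single]

/-- The inclusion of the Laurent polynomials in `h_i`. -/
noncomputable def coeffAt (i : Fin n) : k[T;T⁻¹] →ₐ[k] AddMonoidAlgebra k (Fin n → ℤ) :=
  AddMonoidAlgebra.mapDomainAlgHom k k (AddMonoidHom.single (fun _ : Fin n => ℤ) i)

@[simp] theorem coeffAt_single (i : Fin n) (m : ℤ) (c : k) :
    coeffAt i (AddMonoidAlgebra.single m c) = AddMonoidAlgebra.single (Pi.single i m) c :=
  AddMonoidAlgebra.mapDomain_single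

theorem coeffAt_T (i : Fin n) (m : ℤ) :
    coeffAt i (LaurentPolynomial.T m : k[T;T⁻¹]) = AddMonoidAlgebra.single (Pi.single i m) 1 :=
  coeffAt_single i m 1

theorem coeffAt_injective (i : Fin n) : Function.Injective (coeffAt (k := k) i) :=
  AddMonoidAlgebra.mapDomain_injective (Pi.single_injective (M := fun _ : Fin n => ℤ) i)

theorem shift_coeffAt (q : kˣ) (β : Fin n → ℤ) (i : Fin n) (r : k[T;T⁻¹]) :
    shift q β (coeffAt i r) = coeffAt i (laurentScale (q ^ β i) r) := by
  refine AddMonoidAlgebra.algHom_congr ((shift q β).toAlgHom.comp (coeffAt i))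
    ((coeffAt i).comp (laurentScale (q ^ β i)).toAlgHom) (fun m => ?_) r
  simp only [AlgEquiv.toAlgHom_apply, AlgHom.comp_apply, laurentScale_single, coeffAt_single,
    shift_single, dotProduct_single, zpow_mul]

/-- The specialization `h_j ↦ q ^ e`. -/
noncomputable def evalAt (q : kˣ) (j : Fin n) (e : ℤ) :
    AddMonoidAlgebra k (Fin n → ℤ) →ₐ[k] AddMonoidAlgebra k (Fin n → ℤ) :=
  AddMonoidAlgebra.lift k _ (Fin n → ℤ)
    { toFun := fun α => AddMonoidAlgebra.single (Function.update α.toAdd j 0)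
        ((q ^ (e * α.toAdd j) : kˣ) : k)
      map_one' := by simp [AddMonoidAlgebra.one_def]
      map_mul' := fun a b => by
        rw [AddMonoidAlgebra.single_mul_single, ← Function.update_add, add_zero, toAdd_mul,
          Pi.add_apply, mul_add, zpow_add, Units.val_mul] }

theorem evalAt_single (q : kˣ) (j : Fin n) (e : ℤ) (α : Fin n → ℤ) (c : k) :
    evalAt q j e (AddMonoidAlgebra.single α c) =
      AddMonoidAlgebra.single (Function.update α j 0) (c * ((q ^ (e * α j) : kˣ) : k)) := by
  simp [evalAt, AddMonoidAlgebra.lift_single]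

/-- The shifted polynomial is `q ^ (e d) h_j ^ d - 1`, which has the root `h_j = q ^ (-e)`. -/
theorem evalAt_coeffAt_shift (q : kˣ) (j : Fin n) (e : ℤ) (d : ℕ) :
    evalAt q j (-e) (coeffAt j (laurentScale (q ^ e) (LaurentPolynomial.T (d : ℤ) - 1))) = 0 := by
  rw [map_sub, map_sub, map_sub, map_one, map_one, map_one, LaurentPolynomial.T,
    laurentScale_single, coeffAt_single, evalAt_single, sub_eq_zero, AddMonoidAlgebra.one_def]
  congr 1
  · rw [Pi.single, Function.update_idem, Function.update_eq_self_iff, Pi.zero_apply]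
  · rw [Pi.single_eq_same, ← zpow_mul, one_mul, ← Units.val_mul, ← zpow_add]
    simp

end QWA

end QuantumWeylAnalogue
section QuantumWeylAnalogue

variable {k : Type u} [Field k]

/-! ### Homogeneous elements of the tensor power -/

namespace QWA

variable (n d : ℕ) (q : kˣ)

instance : IsScalarTower k (QWA n d q) (QWA n d q) :=
  @IsScalarTower.right k (QWA n d q) _ _ _

instance : SMulCommClass k (QWA n d q) (QWA n d q) :=
  @Algebra.to_smulCommClass k (QWA n d q) _ _ _

/-- The tensor product of the homogeneous generators of degree `β i`. -/
noncomputable def xPow (β : Fin n → ℤ) : QWA n d q :=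
  PiTensorProduct.tprod k fun i => QWeyl.xPow d q (β i)

theorem coeff_single (α : Fin n → ℤ) (c : k) :
    coeff n d q (AddMonoidAlgebra.single α c) =
      c • PiTensorProduct.tprod k fun i => QWeyl.hPow d q (α i) := by
  simp [coeff, AddMonoidAlgebra.lift_single]

theorem inFactor_eq_tprod (i : Fin n) (a : QWeyl d q) :
    inFactor n d q i a = PiTensorProduct.tprod k (Pi.mulSingle i a) := rfl

theorem inFactor_coeff (i : Fin n) (r : k[T;T⁻¹]) :
    inFactor n d q i (QWeyl.coeff d q r) = coeff n d q (coeffAt i r) := by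
  refine AddMonoidAlgebra.algHom_congr ((inFactor n d q i).comp (QWeyl.coeff d q))
    ((coeff n d q).comp (coeffAt i)) (fun m => ?_) r
  rw [AlgHom.comp_apply, AlgHom.comp_apply, coeffAt_single, coeff_single, one_smul,
    inFactor_eq_tprod]
  congr 1
  funext j
  rcases eq_or_ne j i with rfl | hj
  · rw [Pi.mulSingle_eq_same, Pi.single_eq_same]
    rfl
  · rw [Pi.mulSingle_eq_of_ne hj, Pi.single_eq_of_ne hj, QWeyl.hPow, LaurentPolynomial.T_zero,
      map_one]

theorem tprod_coeff (c : Fin n → k[T;T⁻¹]) :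
    (PiTensorProduct.tprod k fun i => QWeyl.coeff d q (c i)) =
      coeff n d q (∏ i, coeffAt i (c i)) := by
  rw [PiTensorProduct.tprod_eq_noncommProd, ← Finset.noncommProd_eq_prod]
  refine Eq.trans ?_ (Finset.map_noncommProd _ _ _ (coeff n d q)).symm
  exact Finset.noncommProd_congr rfl (fun i _ => inFactor_coeff n d q i (c i)) _

@[simp] theorem xPow_zero : xPow n d q 0 = 1 := by
  simp [xPow, PiTensorProduct.one_def, Pi.one_def]

theorem xPow_single (i : Fin n) (m : ℤ) :
    xPow n d q (Pi.single i m) = inFactor n d q i (QWeyl.xPow d q m) := by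
  rw [inFactor_eq_tprod, xPow]
  congr 1
  funext j
  rcases eq_or_ne j i with rfl | hj
  · simp
  · simp [hj]

theorem xPow_single_one (i : Fin n) : xPow n d q (Pi.single i 1) = x n d q i := by
  rw [xPow_single, QWeyl.xPow_one, x]

theorem xPow_single_neg_one (i : Fin n) : xPow n d q (Pi.single i (-1)) = y n d q i := by
  rw [xPow_single, QWeyl.xPow_neg_one, y]

theorem coeff_single_single_one (i : Fin n) :
    coeff n d q (AddMonoidAlgebra.single (Pi.single i 1) 1) = h n d q i := by
  rw [← coeffAt_T, ← inFactor_coeff]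
  rfl

theorem y_mul_x (i : Fin n) :
    y n d q i * x n d q i =
      coeff n d q (coeffAt i (LaurentPolynomial.T (d : ℤ) - 1)) := by
  rw [y, x, ← map_mul, QWeyl.y_mul_x, inFactor_coeff]

theorem x_mul_y (i : Fin n) :
    x n d q i * y n d q i =
      coeff n d q (coeffAt i (laurentScale q (LaurentPolynomial.T (d : ℤ) - 1))) := by
  rw [y, x, ← map_mul, QWeyl.x_mul_y, inFactor_coeff]

theorem xPow_mul_coeff (β : Fin n → ℤ) (r : AddMonoidAlgebra k (Fin n → ℤ)) :
    xPow n d q β * coeff n d q r = coeff n d q (shift q β r) * xPow n d q β := by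
  induction r using AddMonoidAlgebra.induction_linear with
  | zero => simp
  | add r s hr hs => rw [map_add, mul_add, hr, hs, map_add, map_add, add_mul]
  | single α c =>
    rw [shift_single, coeff_single, coeff_single, xPow, mul_smul_comm, smul_mul_assoc, mul_smul,
      PiTensorProduct.tprod_mul_tprod, PiTensorProduct.tprod_mul_tprod]
    congr 1
    have (i : Fin n) : QWeyl.xPow d q (β i) * QWeyl.hPow d q (α i) =
        ((q ^ (β i * α i) : kˣ) : k) • (QWeyl.hPow d q (α i) * QWeyl.xPow d q (β i)) := by
      rw [QWeyl.hPow, QWeyl.xPow_mul_coeff, laurentScale_T, map_smul, smul_mul_assoc, zpow_mul]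
    have hprod : ∏ i, ((q ^ (β i * α i) : kˣ) : k) = ((q ^ (β ⬝ᵥ α) : kˣ) : k) := by
      rw [← Units.coe_prod]
      exact congrArg _ (map_sum (zmultiplesHom (Additive kˣ) (Additive.ofMul q))
        (fun i => β i * α i) Finset.univ).symm
    rw [← hprod, ← MultilinearMap.map_smul_univ]
    exact congrArg _ (funext this)

theorem xPow_mul_xPow (β γ : Fin n → ℤ) :
    ∃ c, xPow n d q β * xPow n d q γ = coeff n d q c * xPow n d q (β + γ) := by
  choose c hc using fun i => QWeyl.xPow_mul_xPow d q (β i) (γ i)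
  refine ⟨∏ i, coeffAt i (c i), ?_⟩
  rw [xPow, xPow, xPow, PiTensorProduct.tprod_mul_tprod, ← tprod_coeff,
    PiTensorProduct.tprod_mul_tprod]
  exact congrArg _ (funext hc)

/-- The product of opposite homogeneous generators of nonzero degree vanishes at a power of `q`. -/
theorem xPow_mul_xPow_neg (β : Fin n → ℤ) :
    ∃ c, xPow n d q β * xPow n d q (-β) = coeff n d q c ∧
      ∀ j, β j ≠ 0 → ∃ e, evalAt q j e c = 0 := by
  choose c hc hdvd using fun i => QWeyl.xPow_mul_xPow_neg d q (β i)
  refine ⟨∏ i, coeffAt i (c i), ?_, fun j hj => ?_⟩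
  · rw [xPow, xPow, ← tprod_coeff, PiTensorProduct.tprod_mul_tprod]
    exact congrArg _ (funext hc)
  · obtain ⟨e, b, hb⟩ := hdvd j hj
    refine ⟨-e, ?_⟩
    rw [map_prod]
    refine Finset.prod_eq_zero (Finset.mem_univ j) ?_
    rw [hb, map_mul, map_mul, evalAt_coeffAt_shift, zero_mul]

/-- The elements with given coefficients with respect to the homogeneous generators. -/
noncomputable def ofCoeffs :
    ((Fin n → ℤ) →₀ AddMonoidAlgebra k (Fin n → ℤ)) →ₗ[k] QWA n d q :=
  Finsupp.lsum k fun β =>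
    (LinearMap.mulRight k (xPow n d q β)).comp (coeff n d q).toLinearMap

@[simp] theorem ofCoeffs_single (β : Fin n → ℤ) (r : AddMonoidAlgebra k (Fin n → ℤ)) :
    ofCoeffs n d q (Finsupp.single β r) = coeff n d q r * xPow n d q β := by
  simp [ofCoeffs, LinearMap.mulRight_apply]

theorem ofCoeffs_surjective : Function.Surjective (ofCoeffs n d q) := by
  rw [← LinearMap.range_eq_top, eq_top_iff]
  rintro z -
  have hmono (r β) : coeff n d q r * xPow n d q β ∈ LinearMap.range (ofCoeffs n d q) :=
    ⟨Finsupp.single β r, ofCoeffs_single n d q β r⟩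
  refine PiTensorProduct.mem_of_left_mul_mem _ ?_ (fun i a => ?_) z
  · simpa using hmono 1 0
  · let S : Subalgebra k (QWeyl d q) :=
      { carrier := {a | ∀ z ∈ LinearMap.range (ofCoeffs n d q),
          inFactor n d q i a * z ∈ LinearMap.range (ofCoeffs n d q)}
        mul_mem' := fun {a b} ha hb z hz => by
          rw [map_mul, mul_assoc]
          exact ha _ (hb z hz)
        add_mem' := fun {a b} ha hb z hz => by
          rw [map_add, add_mul]
          exact add_mem (ha z hz) (hb z hz)
        algebraMap_mem' := fun c z hz => by
          rw [AlgHom.commutes, ← Algebra.smul_def]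
          exact Submodule.smul_mem _ c hz }
    have hred (w : QWA n d q)
        (hw : ∀ r β, w * (coeff n d q r * xPow n d q β) ∈ LinearMap.range (ofCoeffs n d q)) :
        ∀ z ∈ LinearMap.range (ofCoeffs n d q), w * z ∈ LinearMap.range (ofCoeffs n d q) := by
      rintro _ ⟨f, rfl⟩
      induction f using Finsupp.induction_linear with
      | zero => simp
      | add f g hf hg => rw [map_add, mul_add]; exact add_mem hf hg
      | single β r => rw [ofCoeffs_single]; exact hw r β
    have hpow (m : ℤ) : QWeyl.xPow d q m ∈ S := by
      refine hred _ fun r β => ?_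
      obtain ⟨c, hc⟩ := xPow_mul_xPow n d q (Pi.single i m) β
      rw [← xPow_single, ← mul_assoc, xPow_mul_coeff, mul_assoc, hc, ← mul_assoc, ← map_mul]
      exact hmono _ _
    refine GWA.mem_of_generators S (fun r => hred _ fun s β => ?_) ?_ ?_ a
    · have : inFactor n d q i (GWA.coeff _ _ r) = coeff n d q (coeffAt i r) :=
        inFactor_coeff n d q i r
      rw [this, ← mul_assoc, ← map_mul]
      exact hmono _ _
    · have := hpow 1
      rwa [QWeyl.xPow_one] at this
    · have := hpow (-1)
      rwa [QWeyl.xPow_neg_one] at this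

/-! ### The embedding into a quantum torus -/

/-- The group `ℤⁿ`, acting on `k[h_1, h_1⁻¹, …, h_n, h_n⁻¹]` by the automorphisms `shift q`. -/
@[nolint unusedArguments]
def ShiftGroup (n : ℕ) {k : Type u} [Field k] (_q : kˣ) : Type := Multiplicative (Fin n → ℤ)

instance : CommGroup (ShiftGroup n q) := inferInstanceAs (CommGroup (Multiplicative (Fin n → ℤ)))

instance : TwoUniqueProds (ShiftGroup n q) :=
  inferInstanceAs (TwoUniqueProds (Multiplicative (Fin n → ℤ)))

namespace ShiftGroup

variable {n}

/-- The element of the shift group with a given exponent vector. -/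
def mk (β : Fin n → ℤ) : ShiftGroup n q := Multiplicative.ofAdd β

theorem mk_injective : Function.Injective (mk (n := n) q) := fun _ _ h => h

theorem mk_surjective : Function.Surjective (mk (n := n) q) := fun β => ⟨β, rfl⟩

theorem mk_add (β γ : Fin n → ℤ) : mk q (β + γ) = mk q β * mk q γ := rfl

theorem mk_nsmul (m : ℕ) (β : Fin n → ℤ) : mk q (m • β) = mk q β ^ m := rfl

noncomputable instance : MulSemiringAction (ShiftGroup n q) (AddMonoidAlgebra k (Fin n → ℤ)) where
  smul g r := shift q (Multiplicative.toAdd (α := Fin n → ℤ) g) r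
  one_smul r := shift_zero q r
  mul_smul _ _ r := shift_add q _ _ r
  smul_zero _ := map_zero (shift q _)
  smul_add _ r s := map_add (shift q _) r s
  smul_one _ := map_one (shift q _)
  smul_mul _ r s := map_mul (shift q _) r s

theorem mk_smul (β : Fin n → ℤ) (r : AddMonoidAlgebra k (Fin n → ℤ)) :
    mk q β • r = shift q β r := rfl

instance : SMulCommClass (ShiftGroup n q) k (AddMonoidAlgebra k (Fin n → ℤ)) where
  smul_comm _ c r := map_smul (shift q _) c r

end ShiftGroup

/-- The quantum torus generated over `k[h_1, h_1⁻¹, …, h_n, h_n⁻¹]` by invertible elements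
`x_1, …, x_n`. -/
abbrev Torus : Type u :=
  SkewMonoidAlgebra (AddMonoidAlgebra k (Fin n → ℤ)) (ShiftGroup n q)

open SkewMonoidAlgebra ShiftGroup

theorem torus_single_mul_single (β γ : Fin n → ℤ) (r s : AddMonoidAlgebra k (Fin n → ℤ)) :
    (single (mk q β) r * single (mk q γ) s : Torus n q) =
      single (mk q (β + γ)) (r * shift q β s) := by
  rw [single_mul_single, mk_add, mk_smul]

/-- The inclusion of `k[h_1, h_1⁻¹, …, h_n, h_n⁻¹]` in the quantum torus. -/
noncomputable def torusCoeff : AddMonoidAlgebra k (Fin n → ℤ) →ₐ[k] Torus n q :=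
  { singleOneRingHom with commutes' := fun _ => rfl }

theorem torusCoeff_apply (r : AddMonoidAlgebra k (Fin n → ℤ)) :
    torusCoeff n q r = single (mk q 0) r := rfl

/-- The homomorphism from the `i`-th tensor factor to the quantum torus. -/
noncomputable def embedFactor (i : Fin n) : QWeyl d q →ₐ[k] Torus n q :=
  GWA.lift ((torusCoeff n q).comp (coeffAt i)) (single (mk q (Pi.single i 1)) 1)
    (single (mk q (Pi.single i (-1))) (coeffAt i (LaurentPolynomial.T (d : ℤ) - 1)))
    (by
      rw [torus_single_mul_single, shift_coeffAt, ← Pi.single_add]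
      simp [torusCoeff_apply])
    (by
      rw [torus_single_mul_single, ← Pi.single_add]
      simp [torusCoeff_apply])
    (fun r => by
      rw [AlgHom.comp_apply, AlgHom.comp_apply, torusCoeff_apply, torusCoeff_apply,
        torus_single_mul_single, torus_single_mul_single, shift_coeffAt]
      simp)
    (fun r => by
      rw [AlgHom.comp_apply, AlgHom.comp_apply, torusCoeff_apply, torusCoeff_apply,
        torus_single_mul_single, torus_single_mul_single, shift_coeffAt, shift_zero,
        laurentScale_symm, mul_comm]
      simp)

theorem embedFactor_coeff (i : Fin n) (r : k[T;T⁻¹]) :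
    embedFactor n d q i (QWeyl.coeff d q r) = torusCoeff n q (coeffAt i r) :=
  GWA.lift_coeff ..

theorem embedFactor_x (i : Fin n) :
    embedFactor n d q i (QWeyl.x d q) = single (mk q (Pi.single i 1)) 1 :=
  GWA.lift_x ..

theorem embedFactor_y (i : Fin n) :
    embedFactor n d q i (QWeyl.y d q) =
      single (mk q (Pi.single i (-1))) (coeffAt i (LaurentPolynomial.T (d : ℤ) - 1)) :=
  GWA.lift_y ..

theorem pairwise_commute_embedFactor :
    Pairwise fun i j : Fin n =>
      ∀ a b, Commute (embedFactor n d q i a) (embedFactor n d q j b) := by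
  intro i j hij a b
  -- The generators of the `i`-th factor map to monomials in `X_i` with coefficients in `h_i` alone.
  -- Such monomials commute for distinct indices, and centralizers extend this from generators to
  -- the whole factors.
  let P (i : Fin n) (z : Torus n q) : Prop :=
    ∃ m r, z = single (mk q (Pi.single i m)) (coeffAt i r)
  have hc (i r) : P i (embedFactor n d q i (GWA.coeff _ _ r)) :=
    ⟨0, r, by
      rw [Pi.single_zero]
      exact embedFactor_coeff n d q i r⟩
  have hx (i) : P i (embedFactor n d q i (GWA.x _ _)) :=
    ⟨1, 1, by
      rw [map_one]
      exact embedFactor_x n d q i⟩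
  have hy (i) : P i (embedFactor n d q i (GWA.y _ _)) := ⟨-1, _, embedFactor_y n d q i⟩
  have hcomm (z w) (hz : P i z) (hw : P j w) : Commute z w := by
    obtain ⟨m, r, rfl⟩ := hz
    obtain ⟨l, s, rfl⟩ := hw
    rw [Commute, SemiconjBy, torus_single_mul_single, torus_single_mul_single, shift_coeffAt,
      shift_coeffAt, Pi.single_eq_of_ne hij, Pi.single_eq_of_ne hij.symm, zpow_zero,
      laurentScale_one, laurentScale_one, add_comm, mul_comm]
  have hred (i : Fin n) (z : Torus n q) (H : ∀ w, P i w → Commute w z) (a : QWeyl d q) :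
      Commute (embedFactor n d q i a) z := by
    have := GWA.mem_of_generators ((Subalgebra.centralizer k {z}).comap (embedFactor n d q i))
      (fun r => by simpa [Subalgebra.mem_centralizer_iff] using (H _ (hc i r)).symm.eq)
      (by simpa [Subalgebra.mem_centralizer_iff] using (H _ (hx i)).symm.eq)
      (by simpa [Subalgebra.mem_centralizer_iff] using (H _ (hy i)).symm.eq) a
    exact ((Subalgebra.mem_centralizer_iff k).1 this z rfl).symm
  exact hred i _ (fun z hz => (hred j z (fun w hw => (hcomm z w hz hw).symm) b).symm) a

/-- The embedding into the quantum torus. -/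
noncomputable def embed : QWA n d q →ₐ[k] Torus n q :=
  PiTensorProduct.liftCommuting (embedFactor n d q) (pairwise_commute_embedFactor n d q)

theorem embed_inFactor (i : Fin n) (a : QWeyl d q) :
    embed n d q (inFactor n d q i a) = embedFactor n d q i a :=
  PiTensorProduct.liftCommuting_singleAlgHom ..

theorem embed_tprod (a : Fin n → QWeyl d q) :
    embed n d q (PiTensorProduct.tprod k a) =
      Finset.univ.noncommProd (fun i => embedFactor n d q i (a i))
        ((pairwise_commute_embedFactor n d q).set_pairwise _ |>.mono' fun _ _ h => h _ _) :=
  PiTensorProduct.liftCommuting_tprod ..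

theorem embed_coeff (r : AddMonoidAlgebra k (Fin n → ℤ)) :
    embed n d q (coeff n d q r) = single (mk q 0) r := by
  refine AddMonoidAlgebra.algHom_congr ((embed n d q).comp (coeff n d q)) (torusCoeff n q)
    (fun α => ?_) r
  have hα : AddMonoidAlgebra.single α (1 : k) =
      ∏ i, coeffAt i (LaurentPolynomial.T (α i)) := by
    simp only [coeffAt_T]
    rw [AddMonoidAlgebra.prod_single, Finset.univ_sum_single, Finset.prod_const_one]
  rw [AlgHom.comp_apply, hα, ← tprod_coeff, embed_tprod, ← Finset.noncommProd_eq_prod]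
  refine Eq.trans ?_ (Finset.map_noncommProd _ _ _ (torusCoeff n q)).symm
  exact Finset.noncommProd_congr rfl (fun i _ => embedFactor_coeff n d q i _) _

variable {n d q}

theorem coeffAt_T_sub_one_ne_zero (hd : d ≠ 0) (i : Fin n) :
    coeffAt i (LaurentPolynomial.T (d : ℤ) - 1 : k[T;T⁻¹]) ≠ 0 := by
  intro h0
  have h1 := (map_eq_zero_iff _ (coeffAt_injective i)).1 h0
  rw [sub_eq_zero, ← LaurentPolynomial.T_zero] at h1
  have h2 := congrArg (fun r : k[T;T⁻¹] => r.coeff 0) h1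
  have h3 : (Finsupp.single (d : ℤ) (1 : k)) 0 = Finsupp.single (0 : ℤ) (1 : k) 0 := h2
  simp [hd] at h3

theorem embed_xPow (hd : d ≠ 0) (β : Fin n → ℤ) :
    ∃ c, c ≠ 0 ∧ embed n d q (xPow n d q β) = single (mk q β) c := by
  -- Monomials with nonzero coefficient are closed under products, because the coefficient ring is a
  -- domain on which the group acts by automorphisms.
  have hmul {z w : Torus n q} {g g' : ShiftGroup n q} (hz : ∃ c, c ≠ 0 ∧ z = single g c)
      (hw : ∃ c, c ≠ 0 ∧ w = single g' c) : ∃ c, c ≠ 0 ∧ z * w = single (g * g') c := by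
    obtain ⟨c, hc, rfl⟩ := hz
    obtain ⟨c', hc', rfl⟩ := hw
    exact ⟨_, mul_ne_zero hc ((smul_ne_zero_iff_ne g).2 hc'), single_mul_single⟩
  have hone : ∃ c, c ≠ 0 ∧ (1 : Torus n q) = single 1 c := ⟨1, one_ne_zero, rfl⟩
  have hpow {z : Torus n q} {g : ShiftGroup n q} (hz : ∃ c, c ≠ 0 ∧ z = single g c) (m : ℕ) :
      ∃ c, c ≠ 0 ∧ z ^ m = single (g ^ m) c := by
    induction m with
    | zero => simpa using hone
    | succ m ih => rw [pow_succ, pow_succ]; exact hmul ih hz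
  have hfac (i : Fin n) (m : ℤ) : ∃ c, c ≠ 0 ∧
      embedFactor n d q i (QWeyl.xPow d q m) = single (mk q (Pi.single i m)) c := by
    obtain ⟨m, rfl | rfl⟩ := m.eq_nat_or_neg
    · have := hpow ⟨_, one_ne_zero, embedFactor_x n d q i⟩ m
      rwa [← mk_nsmul, ← Pi.single_smul, ← map_pow, nsmul_one] at this
    · have := hpow ⟨_, coeffAt_T_sub_one_ne_zero hd i, embedFactor_y n d q i⟩ m
      rwa [← mk_nsmul, ← Pi.single_smul, ← map_pow, smul_neg, nsmul_one,
        ← QWeyl.xPow_neg_natCast] at this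
  rw [xPow, embed_tprod]
  have hβ : mk q β = ∏ i, mk q (Pi.single i (β i)) :=
    (congrArg (mk q) (Finset.univ_sum_single β).symm).trans
      (ofAdd_sum _ _)
  rw [hβ]
  generalize hs : (Finset.univ : Finset (Fin n)) = s
  clear hs
  induction s using Finset.induction_on with
  | empty => simpa using hone
  | insert i s hi ih =>
    rw [Finset.noncommProd_insert_of_notMem _ _ _ _ hi, Finset.prod_insert hi]
    exact hmul (hfac i _) ih

end QWA

end QuantumWeylAnalogue
section QuantumWeylAnalogue

variable {k : Type u} [Field k]

namespace QWA

open SkewMonoidAlgebra ShiftGroup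

variable {n d : ℕ} {q : kˣ}

/-! ### Injectivity of the embedding. -/

theorem coeff_injective : Function.Injective (coeff n d q) := fun r s h => by
  have := congrArg (embed n d q) h
  rw [embed_coeff, embed_coeff] at this
  exact single_injective _ this

/-- In terms of coefficients the embedding is diagonal, with nonzero multipliers `c β`. An element
of the algebra is therefore determined by its image, and a vanishing component of the image forces
the corresponding coefficient to vanish. -/
theorem exists_coeff_embed_ofCoeffs (hd : d ≠ 0) :
    ∃ c : (Fin n → ℤ) → AddMonoidAlgebra k (Fin n → ℤ), (∀ β, c β ≠ 0) ∧
      ∀ f β, (embed n d q (ofCoeffs n d q f)).coeff (mk q β) = f β * c β := by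
  classical
  choose c hc hemb using embed_xPow (n := n) (q := q) hd
  refine ⟨c, hc, fun f β => ?_⟩
  induction f using Finsupp.induction_linear with
  | zero => simp
  | add f g hf hg => simp [hf, hg, add_mul]
  | single γ r =>
    rw [ofCoeffs_single, map_mul, embed_coeff, hemb, torus_single_mul_single, zero_add, shift_zero,
      coeff_single_apply, Finsupp.single_apply]
    by_cases h : γ = β
    · subst h; simp
    · rw [if_neg h, if_neg fun e => h (mk_injective q e), zero_mul]

theorem embed_injective (hd : d ≠ 0) : Function.Injective (embed n d q) := by
  obtain ⟨c, hc, hf⟩ := exists_coeff_embed_ofCoeffs (n := n) (q := q) hd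
  rw [injective_iff_map_eq_zero]
  intro z hz
  obtain ⟨f, rfl⟩ := ofCoeffs_surjective n d q z
  have : f = 0 := by
    ext1 β
    have := hf f β
    rw [hz] at this
    exact (mul_eq_zero.1 this.symm).resolve_right (hc β)
  rw [this, map_zero]

/-! ### The grading -/

/-- The elements of degree `β`, where `h_i` has degree `0` and `x_i` is of degree `1` in the `i`-th
direction. -/
def IsHomogeneous (β : Fin n → ℤ) (z : QWA n d q) : Prop :=
  ∃ r, embed n d q z = single (mk q β) r

theorem isHomogeneous_iff (hd : d ≠ 0) {β : Fin n → ℤ} {z : QWA n d q} :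
    IsHomogeneous β z ↔ ∃ s, z = coeff n d q s * xPow n d q β := by
  constructor
  · rintro ⟨r, hr⟩
    obtain ⟨c, hc, hf⟩ := exists_coeff_embed_ofCoeffs (n := n) (q := q) hd
    obtain ⟨f, rfl⟩ := ofCoeffs_surjective n d q z
    refine ⟨f β, ?_⟩
    rw [← ofCoeffs_single]
    congr 1
    ext1 γ
    classical
    rw [Finsupp.single_apply]
    split_ifs with h
    · rw [h]
    · have := hf f γ
      rw [hr, coeff_single_apply, if_neg fun e => h (mk_injective q e)] at this
      exact (mul_eq_zero.1 this.symm).resolve_right (hc γ)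
  · rintro ⟨s, rfl⟩
    obtain ⟨c, -, hc⟩ := embed_xPow (n := n) (q := q) hd β
    exact ⟨_, by rw [map_mul, embed_coeff, hc, torus_single_mul_single, zero_add]⟩

theorem isHomogeneous_xPow (hd : d ≠ 0) (β : Fin n → ℤ) : IsHomogeneous β (xPow n d q β) :=
  (isHomogeneous_iff hd).2 ⟨1, by rw [map_one, one_mul]⟩

theorem isHomogeneous_coeff (r : AddMonoidAlgebra k (Fin n → ℤ)) :
    IsHomogeneous 0 (coeff n d q r) :=
  ⟨r, embed_coeff n d q r⟩

theorem IsHomogeneous.mul {β γ : Fin n → ℤ} {z w : QWA n d q} (hz : IsHomogeneous β z)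
    (hw : IsHomogeneous γ w) : IsHomogeneous (β + γ) (z * w) := by
  obtain ⟨r, hr⟩ := hz
  obtain ⟨s, hs⟩ := hw
  exact ⟨_, by rw [map_mul, hr, hs, torus_single_mul_single]⟩

theorem IsHomogeneous.pow {β : Fin n → ℤ} {z : QWA n d q} (hz : IsHomogeneous β z) (m : ℕ) :
    IsHomogeneous (m • β) (z ^ m) := by
  induction m with
  | zero => simpa using isHomogeneous_coeff (d := d) (q := q) (1 : AddMonoidAlgebra k (Fin n → ℤ))
  | succ m ih => rw [pow_succ, succ_nsmul]; exact ih.mul hz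

theorem IsHomogeneous.eq_of_ne_zero (hd : d ≠ 0) {β γ : Fin n → ℤ} {z : QWA n d q}
    (hβ : IsHomogeneous β z) (hγ : IsHomogeneous γ z) (hz : z ≠ 0) : β = γ := by
  obtain ⟨r, hr⟩ := hβ
  obtain ⟨s, hs⟩ := hγ
  have hr0 : r ≠ 0 := by
    rintro rfl
    rw [single_zero_right, map_eq_zero_iff _ (embed_injective hd)] at hr
    exact hz hr
  have h := hs.symm.trans hr
  have := congrArg (fun w : Torus n q => w.coeff (mk q β)) h
  classical
  simp only [coeff_single_apply, if_true] at this
  by_contra hne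
  rw [if_neg fun e => hne (mk_injective q e).symm] at this
  exact hr0 this.symm

theorem xPow_ne_zero (hd : d ≠ 0) (β : Fin n → ℤ) : xPow n d q β ≠ 0 := by
  obtain ⟨c, hc, h⟩ := embed_xPow (n := n) (q := q) hd β
  intro h0
  rw [h0, map_zero] at h
  exact hc (single_eq_zero.1 h.symm)

/-- The factors of a nonzero element of degree `0` that is a coefficient are homogeneous. -/
theorem exists_isHomogeneous_of_mul_eq_coeff {z w : QWA n d q}
    {r : AddMonoidAlgebra k (Fin n → ℤ)} (hr : r ≠ 0) (h : z * w = coeff n d q r) :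
    ∃ β, IsHomogeneous (-β) z ∧ IsHomogeneous β w := by
  have h' : embed n d q z * embed n d q w = single (mk q 0) r := by
    rw [← map_mul, h, embed_coeff]
  obtain ⟨⟨a, s, ha⟩, b, s', hb⟩ := eq_single_of_mul_eq_single hr h'
  obtain ⟨β, rfl⟩ := mk_surjective q a
  obtain ⟨γ, rfl⟩ := mk_surjective q b
  refine ⟨γ, ⟨s, ?_⟩, s', hb⟩
  rw [ha, hb, torus_single_mul_single] at h'
  have hβγ : β + γ = 0 := by
    by_contra hne
    have := congrArg (fun w : Torus n q => w.coeff (mk q 0)) h'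
    classical
    simp only [coeff_single_apply, if_true] at this
    rw [if_neg fun e => hne (mk_injective q e)] at this
    exact hr this.symm
  rw [ha, eq_neg_of_add_eq_zero_left hβγ]

theorem coeff_mul_xPow_mul_coeff_mul_xPow_neg (s t : AddMonoidAlgebra k (Fin n → ℤ))
    (β : Fin n → ℤ) :
    coeff n d q s * xPow n d q β * (coeff n d q t * xPow n d q (-β)) =
      coeff n d q (s * shift q β t) * (xPow n d q β * xPow n d q (-β)) := by
  rw [mul_assoc, ← mul_assoc (xPow n d q β), xPow_mul_coeff, map_mul]
  simp only [mul_assoc]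

/-- Both factors are homogeneous, of opposite degrees. Once the degree is known to be zero, the
equation lives in the Laurent polynomial ring, whose units are scaled monomials. -/
theorem exists_eq_coeff_single_of_mul_eq_one (hd : d ≠ 0) {z w : QWA n d q} (h : z * w = 1) :
    ∃ α c, c ≠ 0 ∧ z = coeff n d q (AddMonoidAlgebra.single α c) := by
  rw [← map_one (coeff n d q)] at h
  obtain ⟨γ, hz, hw⟩ := exists_isHomogeneous_of_mul_eq_coeff one_ne_zero h
  obtain ⟨β, rfl⟩ : ∃ β, γ = -β := ⟨-γ, (neg_neg γ).symm⟩
  rw [neg_neg] at hz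
  obtain ⟨s, rfl⟩ := (isHomogeneous_iff hd).1 hz
  obtain ⟨t, rfl⟩ := (isHomogeneous_iff hd).1 hw
  obtain ⟨D, hD, hev⟩ := xPow_mul_xPow_neg n d q β
  rw [coeff_mul_xPow_mul_coeff_mul_xPow_neg, hD, ← map_mul] at h
  have h1 := coeff_injective h
  -- In a nonzero degree the specialization `h_j = q ^ e` would turn the equation into `0 = 1`.
  have hβ : β = 0 := by
    by_contra hβ
    obtain ⟨j, hj⟩ := Function.ne_iff.1 hβ
    obtain ⟨e, he⟩ := hev j hj
    have := congrArg (evalAt q j e) h1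
    rw [map_mul, he, mul_zero, map_one] at this
    exact zero_ne_one this
  rw [mul_assoc] at h1
  obtain ⟨α, c, hc, rfl⟩ := AddMonoidAlgebra.eq_single_of_mul_eq_one h1
  exact ⟨α, c, hc, by rw [hβ, xPow_zero, mul_one]⟩

/-! ### Automorphisms -/

theorem single_left_injective {α α' : Fin n → ℤ} {c c' : k} (hc : c ≠ 0)
    (h : AddMonoidAlgebra.single α c = AddMonoidAlgebra.single α' c') : α = α' ∧ c = c' := by
  have h' : Finsupp.single α c = Finsupp.single α' c' := congrArg AddMonoidAlgebra.coeff h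
  rw [Finsupp.single_eq_single_iff] at h'
  exact h'.resolve_right fun e => hc e.1

/-- Monomials in the `h_i` are units, so their images are scaled monomials. Additivity of the
exponent map follows by comparing exponents of images of products. -/
theorem exists_map_single (hd : d ≠ 0) (ψ : QWA n d q ≃ₐ[k] QWA n d q) :
    ∃ μ : (Fin n → ℤ) →+ (Fin n → ℤ), ∀ α, ∃ c : k, c ≠ 0 ∧
      ψ (coeff n d q (AddMonoidAlgebra.single α 1)) =
        coeff n d q (AddMonoidAlgebra.single (μ α) c) := by
  have hunit (α : Fin n → ℤ) : ψ (coeff n d q (AddMonoidAlgebra.single α 1)) *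
      ψ (coeff n d q (AddMonoidAlgebra.single (-α) 1)) = 1 := by
    rw [← map_mul, ← map_mul, AddMonoidAlgebra.single_mul_single, add_neg_cancel, one_mul,
      ← AddMonoidAlgebra.one_def, map_one, map_one]
  choose μ c hc hψ using fun α => exists_eq_coeff_single_of_mul_eq_one hd (hunit α)
  refine ⟨AddMonoidHom.mk' μ fun α α' => ?_, fun α => ⟨c α, hc α, hψ α⟩⟩
  have h := hψ (α + α')
  rw [← one_mul (1 : k), ← AddMonoidAlgebra.single_mul_single, map_mul, map_mul, hψ, hψ, ← map_mul,
    AddMonoidAlgebra.single_mul_single] at h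
  exact (single_left_injective (mul_ne_zero (hc _) (hc _)) (coeff_injective h)).1.symm

theorem exists_map_coeff (hd : d ≠ 0) (ψ : QWA n d q ≃ₐ[k] QWA n d q)
    (r : AddMonoidAlgebra k (Fin n → ℤ)) : ∃ s, ψ (coeff n d q r) = coeff n d q s := by
  obtain ⟨μ, hμ⟩ := exists_map_single hd ψ
  induction r using AddMonoidAlgebra.induction_linear with
  | zero => exact ⟨0, by simp⟩
  | add r s hr hs =>
    obtain ⟨r', hr⟩ := hr
    obtain ⟨s', hs⟩ := hs
    exact ⟨r' + s', by rw [map_add, map_add, hr, hs, map_add]⟩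
  | single α c =>
    obtain ⟨c', -, h⟩ := hμ α
    refine ⟨c • AddMonoidAlgebra.single (μ α) c', ?_⟩
    rw [← mul_one c, ← smul_eq_mul, ← AddMonoidAlgebra.smul_single, map_smul, map_smul, h,
      smul_eq_mul, mul_one, map_smul]

/-- Applied to `ψ` and `ψ.symm`, this makes the exponent map of `ψ` invertible on one side, which
later forces exponents to be `±1` and the induced map of indices to be injective. -/
theorem exponents_comp {ψ φ : QWA n d q ≃ₐ[k] QWA n d q} {μ ν : (Fin n → ℤ) →+ (Fin n → ℤ)}
    (hμ : ∀ α, ∃ c : k, c ≠ 0 ∧ ψ (coeff n d q (AddMonoidAlgebra.single α 1)) =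
      coeff n d q (AddMonoidAlgebra.single (μ α) c))
    (hν : ∀ α, ∃ c : k, c ≠ 0 ∧ φ (coeff n d q (AddMonoidAlgebra.single α 1)) =
      coeff n d q (AddMonoidAlgebra.single (ν α) c)) (h : ∀ z, φ (ψ z) = z) (α : Fin n → ℤ) :
    ν (μ α) = α := by
  obtain ⟨c, hc, h1⟩ := hμ α
  obtain ⟨c', hc', h2⟩ := hν (μ α)
  have h3 := h (coeff n d q (AddMonoidAlgebra.single α 1))
  rw [h1, ← mul_one c, ← smul_eq_mul, ← AddMonoidAlgebra.smul_single, map_smul, map_smul, h2,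
    ← map_smul, AddMonoidAlgebra.smul_single] at h3
  exact (single_left_injective (mul_ne_zero hc hc') (coeff_injective h3)).1

/-! ### Images of the generators under an automorphism. -/

theorem isHomogeneous_x (hd : d ≠ 0) (i : Fin n) :
    IsHomogeneous (Pi.single i 1) (x n d q i) :=
  xPow_single_one n d q i ▸ isHomogeneous_xPow hd _

theorem x_ne_zero (hd : d ≠ 0) (i : Fin n) : x n d q i ≠ 0 :=
  xPow_single_one n d q i ▸ xPow_ne_zero hd _

theorem exists_isHomogeneous_map (hd : d ≠ 0) (ψ : QWA n d q ≃ₐ[k] QWA n d q) (i : Fin n) :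
    ∃ β, IsHomogeneous (-β) (ψ (y n d q i)) ∧ IsHomogeneous β (ψ (x n d q i)) := by
  obtain ⟨s, hs⟩ := exists_map_coeff hd ψ (coeffAt i (LaurentPolynomial.T (d : ℤ) - 1))
  refine exists_isHomogeneous_of_mul_eq_coeff (r := s) ?_ ?_
  · rintro rfl
    rw [map_zero, map_eq_zero_iff _ ψ.injective, map_eq_zero_iff _ coeff_injective] at hs
    exact coeffAt_T_sub_one_ne_zero hd i hs
  · rw [← map_mul, y_mul_x, hs]

theorem coeffAt_T_sub_one (i : Fin n) :
    coeffAt i (LaurentPolynomial.T (d : ℤ) - 1 : k[T;T⁻¹]) =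
      AddMonoidAlgebra.single (Pi.single i 1) 1 ^ d - 1 := by
  rw [map_sub, map_one, coeffAt_T, AddMonoidAlgebra.single_pow, one_pow, ← Pi.single_smul,
    nsmul_one]

theorem map_y_mul_x {ψ : QWA n d q ≃ₐ[k] QWA n d q} {i : Fin n} {m : Fin n → ℤ} {c : k}
    (h : ψ (coeff n d q (AddMonoidAlgebra.single (Pi.single i 1) 1)) =
      coeff n d q (AddMonoidAlgebra.single m c)) :
    ψ (y n d q i) * ψ (x n d q i) = coeff n d q (AddMonoidAlgebra.single (d • m) (c ^ d) - 1) := by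
  rw [← map_mul, y_mul_x, coeffAt_T_sub_one, map_sub, map_sub, map_pow, map_pow, h, map_one,
    map_one, map_sub, map_one, ← map_pow, AddMonoidAlgebra.single_pow]

/-- When `ψ(x_i)` has nonzero degree in direction `j`, the product `ψ(y_i) ψ(x_i) = (c h ^ m) ^ d -
1` vanishes at some `h_j = q ^ e`. The specialized monomial is then constant, so `d * m l = 0` for
every other index `l`. -/
theorem apply_eq_zero_of_ne (hd : d ≠ 0) {ψ : QWA n d q ≃ₐ[k] QWA n d q} {i : Fin n}
    {m β : Fin n → ℤ} {c : k} (hc : c ≠ 0)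
    (h : ψ (coeff n d q (AddMonoidAlgebra.single (Pi.single i 1) 1)) =
      coeff n d q (AddMonoidAlgebra.single m c))
    (hy : IsHomogeneous (-β) (ψ (y n d q i))) (hx : IsHomogeneous β (ψ (x n d q i))) {j l : Fin n}
    (hj : β j ≠ 0) (hl : l ≠ j) : m l = 0 := by
  obtain ⟨s, hs⟩ := (isHomogeneous_iff hd).1 hy
  obtain ⟨t, ht⟩ := (isHomogeneous_iff hd).1 hx
  obtain ⟨D, hD, hev⟩ := xPow_mul_xPow_neg n d q (-β)
  have h1 := map_y_mul_x h
  have h2 := coeff_mul_xPow_mul_coeff_mul_xPow_neg (d := d) (q := q) s t (-β)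
  rw [hD, neg_neg] at h2
  rw [hs, ht, h2, ← map_mul] at h1
  obtain ⟨e, he⟩ := hev j (by simpa using hj)
  have h3 := congrArg (evalAt q j e) (coeff_injective h1)
  rw [map_mul, he, mul_zero, map_sub, map_one, eq_comm, sub_eq_zero, evalAt_single,
    AddMonoidAlgebra.one_def] at h3
  have h4 := (single_left_injective (mul_ne_zero (pow_ne_zero d hc) (Units.ne_zero _)) h3).1
  have h5 := congrFun h4 l
  rw [Function.update_of_ne hl] at h5
  simpa [hd] using h5

/-- An automorphism maps `h_i` to a multiple of `h_j` or `h_j⁻¹`, and `x_i` correspondingly to an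
element of the same degree as `x_j` or `y_j`. -/
theorem exists_signed_index (hd : d ≠ 0) (hq : q ^ 2 ≠ 1) {ψ : QWA n d q ≃ₐ[k] QWA n d q}
    {μ : (Fin n → ℤ) →+ (Fin n → ℤ)}
    (hμ : ∀ α, ∃ c : k, c ≠ 0 ∧ ψ (coeff n d q (AddMonoidAlgebra.single α 1)) =
      coeff n d q (AddMonoidAlgebra.single (μ α) c)) (i : Fin n) :
    ∃ j ε, (ε = 1 ∨ ε = -1) ∧ μ (Pi.single i 1) = Pi.single j ε ∧
      IsHomogeneous (Pi.single j (-ε)) (ψ (y n d q i)) ∧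
      IsHomogeneous (Pi.single j ε) (ψ (x n d q i)) := by
  obtain ⟨β, hy, hx⟩ := exists_isHomogeneous_map hd ψ i
  obtain ⟨ν, hν⟩ := exists_map_single hd ψ.symm
  have hνμ := exponents_comp hμ hν ψ.symm_apply_apply
  obtain ⟨c, hc, hψh⟩ := hμ (Pi.single i 1)
  have hzero {j l : Fin n} (hj : β j ≠ 0) (hl : l ≠ j) : μ (Pi.single i 1) l = 0 :=
    apply_eq_zero_of_ne hd hc hψh hy hx hj hl
  -- In degree zero `ψ(x_i)` would be a Laurent polynomial in the `h`'s; `ψ.symm` preserves these,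
  -- so `x_i` would have degree zero.
  have hβ : β ≠ 0 := by
    rintro rfl
    obtain ⟨t, ht⟩ := (isHomogeneous_iff hd).1 hx
    obtain ⟨s, hs⟩ := exists_map_coeff hd ψ.symm t
    rw [xPow_zero, mul_one] at ht
    rw [← ht, ψ.symm_apply_apply] at hs
    have := (isHomogeneous_x hd i).eq_of_ne_zero hd (hs ▸ isHomogeneous_coeff s) (x_ne_zero hd i)
    simpa using congrFun this i
  obtain ⟨j, hj⟩ := Function.ne_iff.1 hβ
  have hμj : μ (Pi.single i 1) = Pi.single j (μ (Pi.single i 1) j) := by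
    funext l
    rcases eq_or_ne l j with rfl | hl
    · rw [Pi.single_eq_same]
    · rw [Pi.single_eq_of_ne hl, hzero hj hl]
  generalize hm : μ (Pi.single i 1) j = m at hμj
  -- Since `ν (μ e_i) = e_i` and `μ e_i = m e_j`, the integer `m` divides `1`.
  have hm1 : m = 1 ∨ m = -1 := by
    have h1 := hνμ (Pi.single i 1)
    rw [hμj, show (Pi.single j m : Fin n → ℤ) = m • Pi.single j 1 by
      rw [← Pi.single_smul, smul_eq_mul, mul_one], map_zsmul] at h1
    have h2 := congrFun h1 i
    rw [Pi.smul_apply, smul_eq_mul, Pi.single_eq_same] at h2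
    exact Int.eq_one_or_neg_one_of_mul_eq_one h2
  have hm0 : m ≠ 0 := by rcases hm1 with rfl | rfl <;> decide
  -- A second direction `l` with `β l ≠ 0` would force the exponent `m` at `j` to vanish.
  have hβj : β = Pi.single j (β j) := by
    funext l
    rcases eq_or_ne l j with rfl | hl
    · rw [Pi.single_eq_same]
    · rw [Pi.single_eq_of_ne hl]
      by_contra hl0
      exact hm0 (hm ▸ hzero hl0 hl.symm)
  generalize β j = b at hβj hj
  subst hβj
  obtain ⟨t, ht⟩ := (isHomogeneous_iff hd).1 hx
  -- Applying `ψ.symm` to `ψ(x_i) = t * x_j ^ b` (a power of `y_j` if `b < 0`) exhibits `x_i` as an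
  -- element of degree `|b| γ'`, so `|b|` divides `1`.
  have hb1 : b = 1 ∨ b = -1 := by
    obtain ⟨γ, hγy, hγx⟩ := exists_isHomogeneous_map hd ψ.symm j
    have hpow : ∃ γ' : Fin n → ℤ,
        IsHomogeneous (b.natAbs • γ') (ψ.symm (xPow n d q (Pi.single j b))) := by
      rw [xPow_single]
      obtain ⟨p, rfl | rfl⟩ := b.eq_nat_or_neg
      · refine ⟨γ, ?_⟩
        rw [QWeyl.xPow_natCast, map_pow, map_pow, Int.natAbs_natCast]
        exact hγx.pow p
      · refine ⟨-γ, ?_⟩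
        rw [QWeyl.xPow_neg_natCast, map_pow, map_pow, Int.natAbs_neg, Int.natAbs_natCast]
        exact hγy.pow p
    obtain ⟨γ', hγ'⟩ := hpow
    obtain ⟨s, hs⟩ := exists_map_coeff hd ψ.symm t
    have h1 := (isHomogeneous_coeff (d := d) (q := q) s).mul hγ'
    rw [← hs, ← map_mul, ← ht, ψ.symm_apply_apply, zero_add] at h1
    have h2 := congrFun (h1.eq_of_ne_zero hd (isHomogeneous_x hd i) (x_ne_zero hd i)) i
    rw [Pi.smul_apply, nsmul_eq_mul, Pi.single_eq_same] at h2
    have h3 := Int.eq_one_or_neg_one_of_mul_eq_one h2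
    omega
  -- The image of `x_i h_i = q h_i x_i` compares `q` with the scalar produced by moving degree `b`
  -- past `h_j ^ m`. Opposite signs would give `q⁻¹ = q`, which `q ^ 2 ≠ 1` excludes.
  have hbm : q ^ (b * m) = q := by
    have h1 : x n d q i * coeff n d q (AddMonoidAlgebra.single (Pi.single i 1) 1) =
        (q : k) • (coeff n d q (AddMonoidAlgebra.single (Pi.single i 1) 1) * x n d q i) := by
      rw [← xPow_single_one, xPow_mul_coeff, shift_single, ← smul_mul_assoc, ← map_smul,
        AddMonoidAlgebra.smul_single, smul_eq_mul, mul_one, one_mul]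
      simp
    have h2 := congrArg ψ h1
    obtain ⟨r, hr⟩ := hx
    have hr0 : r ≠ 0 := by
      rintro rfl
      rw [single_zero_right, map_eq_zero_iff _ (embed_injective hd),
        map_eq_zero_iff _ ψ.injective] at hr
      exact x_ne_zero hd i hr
    rw [map_mul, map_smul, map_mul, hψh, hμj, ← smul_mul_assoc, ← map_smul] at h2
    have h3 := congrArg (embed n d q) h2
    rw [map_mul, map_mul, hr, embed_coeff, embed_coeff, torus_single_mul_single,
      torus_single_mul_single, zero_add, add_zero, shift_zero, shift_single, mul_comm] at h3
    have h4 := mul_right_cancel₀ hr0 (single_injective _ h3)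
    rw [AddMonoidAlgebra.smul_single] at h4
    have h5 := (single_left_injective (mul_ne_zero hc (Units.ne_zero _)) h4).2
    rw [smul_eq_mul, mul_comm] at h5
    have h6 := Units.ext (mul_right_cancel₀ hc h5)
    simpa using h6
  have hε : b = m := by
    have hinv (h : q ^ (-1 : ℤ) = q) : False := by
      rw [zpow_neg_one, inv_eq_iff_mul_eq_one, ← pow_two] at h
      exact hq h
    rcases hb1 with rfl | rfl <;> rcases hm1 with rfl | rfl
    · rfl
    · exact (hinv (by simpa using hbm)).elim
    · exact (hinv (by simpa using hbm)).elim
    · rfl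
  subst hε
  exact ⟨j, b, hb1, hμj, by rwa [Pi.single_neg], hx⟩

/-- The product `ψ(y_i) ψ(x_i) = c ^ d h_j ^ d - 1` is a multiple of `y_j x_j = h_j ^ d - 1`, which
vanishes at `h_j = 1`. -/
theorem pow_eq_one_of_map_h (hd : d ≠ 0) {ψ : QWA n d q ≃ₐ[k] QWA n d q} {i j : Fin n} {c : k}
    (h : ψ (coeff n d q (AddMonoidAlgebra.single (Pi.single i 1) 1)) =
      coeff n d q (AddMonoidAlgebra.single (Pi.single j 1) c))
    (hy : IsHomogeneous (Pi.single j (-1)) (ψ (y n d q i)))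
    (hx : IsHomogeneous (Pi.single j 1) (ψ (x n d q i))) : c ^ d = 1 := by
  obtain ⟨s, hs⟩ := (isHomogeneous_iff hd).1 hy
  obtain ⟨t, ht⟩ := (isHomogeneous_iff hd).1 hx
  have h1 := map_y_mul_x h
  have h2 := coeff_mul_xPow_mul_coeff_mul_xPow_neg (d := d) (q := q) s t (Pi.single j (-1))
  rw [← Pi.single_neg, neg_neg, xPow_single_neg_one, xPow_single_one, y_mul_x, ← map_mul] at h2
  rw [hs, ht, xPow_single_neg_one, xPow_single_one, h2] at h1
  have h3 := congrArg (evalAt q j 0) (coeff_injective h1)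
  have h4 := evalAt_coeffAt_shift q j 0 d
  rw [zpow_zero, laurentScale_one, neg_zero] at h4
  rw [map_mul, h4, mul_zero, map_sub, map_one, eq_comm, sub_eq_zero, evalAt_single,
    AddMonoidAlgebra.one_def, zero_mul, zpow_zero, Units.val_one, mul_one] at h3
  exact (single_left_injective one_ne_zero h3.symm).2.symm

/-- Here `ψ(y_i) ψ(x_i) = c ^ d h_j ^ (-d) - 1` is a multiple of `x_j y_j = q ^ d h_j ^ d - 1`,
which vanishes at `h_j = q⁻¹`. -/
theorem pow_eq_one_of_map_h_inv (hd : d ≠ 0) {ψ : QWA n d q ≃ₐ[k] QWA n d q} {i j : Fin n} {c : k}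
    (h : ψ (coeff n d q (AddMonoidAlgebra.single (Pi.single i 1) 1)) =
      coeff n d q (AddMonoidAlgebra.single (Pi.single j (-1)) c))
    (hy : IsHomogeneous (Pi.single j 1) (ψ (y n d q i)))
    (hx : IsHomogeneous (Pi.single j (-1)) (ψ (x n d q i))) : (c * q) ^ d = 1 := by
  obtain ⟨s, hs⟩ := (isHomogeneous_iff hd).1 hy
  obtain ⟨t, ht⟩ := (isHomogeneous_iff hd).1 hx
  have h1 := map_y_mul_x h
  have h2 := coeff_mul_xPow_mul_coeff_mul_xPow_neg (d := d) (q := q) s t (Pi.single j 1)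
  rw [← Pi.single_neg, xPow_single_neg_one, xPow_single_one, x_mul_y, ← map_mul] at h2
  rw [hs, ht, xPow_single_neg_one, xPow_single_one, h2] at h1
  have h3 := congrArg (evalAt q j (-1)) (coeff_injective h1)
  have h4 := evalAt_coeffAt_shift q j 1 d
  rw [zpow_one] at h4
  rw [map_mul, h4, mul_zero, map_sub, map_one, eq_comm, sub_eq_zero, evalAt_single,
    AddMonoidAlgebra.one_def] at h3
  have h5 := (single_left_injective one_ne_zero h3.symm).2.symm
  simpa [mul_pow] using h5

end QWA

end QuantumWeylAnalogue
section QuantumWeylAnalogue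

variable {k : Type u} [Field k]

/-! ### Automorphisms of the quantum Weyl analogue algebra -/

theorem laurentScale_comm (q q' : kˣ) (r : k[T;T⁻¹]) :
    laurentScale q (laurentScale q' r) = laurentScale q' (laurentScale q r) := by
  rw [← laurentScale_mul, mul_comm, laurentScale_mul]

theorem laurentScale_T_sub_one (c : kˣ) (d : ℕ) (hc : c ^ d = 1) :
    laurentScale c (LaurentPolynomial.T (d : ℤ) - 1) = LaurentPolynomial.T (d : ℤ) - 1 := by
  rw [map_sub, map_one, laurentScale_T, zpow_natCast, hc, Units.val_one, one_smul]

theorem invert_laurentScale (q : kˣ) (r : k[T;T⁻¹]) :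
    LaurentPolynomial.invert (laurentScale q r) =
      laurentScale q⁻¹ (LaurentPolynomial.invert r) := by
  refine AddMonoidAlgebra.algHom_congr
    (LaurentPolynomial.invert.toAlgHom.comp (laurentScale q).toAlgHom)
    ((laurentScale q⁻¹).toAlgHom.comp LaurentPolynomial.invert.toAlgHom) (fun m => ?_) r
  change LaurentPolynomial.invert (laurentScale q (LaurentPolynomial.T m)) =
    laurentScale q⁻¹ (LaurentPolynomial.invert (LaurentPolynomial.T m))
  rw [laurentScale_T, map_smul, LaurentPolynomial.invert_T, laurentScale_T]
  simp

namespace QWeyl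

variable (d : ℕ) (q : kˣ)

variable {d q} in
theorem algHom_ext {B : Type*} [Ring B] [Algebra k B] {f g : QWeyl d q →ₐ[k] B}
    (hc : ∀ m, f (hPow d q m) = g (hPow d q m)) (hx : f (x d q) = g (x d q))
    (hy : f (y d q) = g (y d q)) : f = g :=
  GWA.algHom_ext (AddMonoidAlgebra.algHom_congr (f.comp (coeff d q)) (g.comp (coeff d q)) hc) hx hy

/-- The endomorphism `h ↦ c h`, `x ↦ x`, `y ↦ y` for `c ^ d = 1`. -/
noncomputable def scaleHom (c : kˣ) (hc : c ^ d = 1) : QWeyl d q →ₐ[k] QWeyl d q :=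
  GWA.lift ((coeff d q).comp (laurentScale c).toAlgHom) (x d q) (y d q)
    (by
      rw [x_mul_y, AlgHom.comp_apply, AlgEquiv.toAlgHom_apply, laurentScale_comm,
        laurentScale_T_sub_one c d hc])
    (by
      rw [y_mul_x, AlgHom.comp_apply, AlgEquiv.toAlgHom_apply, laurentScale_T_sub_one c d hc])
    (fun r => by
      rw [AlgHom.comp_apply, AlgHom.comp_apply, AlgEquiv.toAlgHom_apply, AlgEquiv.toAlgHom_apply,
        x_mul_coeff, laurentScale_comm])
    (fun r => by
      rw [AlgHom.comp_apply, AlgHom.comp_apply, AlgEquiv.toAlgHom_apply, AlgEquiv.toAlgHom_apply,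
        y_mul_coeff, laurentScale_symm, laurentScale_comm])

theorem scaleHom_coeff (c : kˣ) (hc : c ^ d = 1) (r : k[T;T⁻¹]) :
    scaleHom d q c hc (coeff d q r) = coeff d q (laurentScale c r) :=
  GWA.lift_coeff ..

theorem scaleHom_x (c : kˣ) (hc : c ^ d = 1) : scaleHom d q c hc (x d q) = x d q :=
  GWA.lift_x ..

theorem scaleHom_y (c : kˣ) (hc : c ^ d = 1) : scaleHom d q c hc (y d q) = y d q :=
  GWA.lift_y ..

theorem scaleHom_comp (c c' : kˣ) (hc : c ^ d = 1) (hc' : c' ^ d = 1) (h : c * c' = 1) :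
    (scaleHom d q c hc).comp (scaleHom d q c' hc') = AlgHom.id k _ := by
  refine algHom_ext (fun m => ?_) ?_ ?_
  · rw [AlgHom.comp_apply, hPow, scaleHom_coeff, scaleHom_coeff, ← laurentScale_mul, h,
      laurentScale_one, AlgHom.id_apply]
  · rw [AlgHom.comp_apply, scaleHom_x, scaleHom_x, AlgHom.id_apply]
  · rw [AlgHom.comp_apply, scaleHom_y, scaleHom_y, AlgHom.id_apply]

/-- The automorphism `h ↦ c h`, `x ↦ x`, `y ↦ y` for `c ^ d = 1`. -/
noncomputable def scaleEquiv (c : kˣ) (hc : c ^ d = 1) : QWeyl d q ≃ₐ[k] QWeyl d q :=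
  AlgEquiv.ofAlgHom (scaleHom d q c hc) (scaleHom d q c⁻¹ (by rw [inv_pow, hc, inv_one]))
    (scaleHom_comp _ _ _ _ _ _ (mul_inv_cancel c)) (scaleHom_comp _ _ _ _ _ _ (inv_mul_cancel c))

theorem scaleEquiv_hPow (c : kˣ) (hc : c ^ d = 1) (m : ℤ) :
    scaleEquiv d q c hc (hPow d q m) = ((c ^ m : kˣ) : k) • hPow d q m := by
  refine (scaleHom_coeff d q c hc _).trans ?_
  rw [laurentScale_T, map_smul, hPow]

/-- Under `h ↦ q⁻¹ h⁻¹` the value of `x y` becomes a unit multiple of the value of `y x`, which is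
what allows `x` and `y` to be interchanged. The unit `-h ^ (-d)` is the one that `r σ⁻¹(s)` must
equal in `invertHom`. -/
theorem laurentScale_invert_shifted :
    laurentScale q (LaurentPolynomial.invert (laurentScale q (LaurentPolynomial.T (d : ℤ) - 1))) =
      -LaurentPolynomial.T (-(d : ℤ)) * (LaurentPolynomial.T (d : ℤ) - 1 : k[T;T⁻¹]) := by
  rw [invert_laurentScale, ← laurentScale_mul, mul_inv_cancel, laurentScale_one, map_sub, map_one,
    LaurentPolynomial.invert_T, mul_sub, neg_mul, ← LaurentPolynomial.T_add, neg_add_cancel,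
    LaurentPolynomial.T_zero]
  ring

/-- The endomorphism `h ↦ q⁻¹ h⁻¹`, `x ↦ r y`, `y ↦ s x` for `r σ⁻¹(s) = -h ^ (-d)`. -/
noncomputable def invertHom (r s : k[T;T⁻¹])
    (hrs : r * laurentScale q⁻¹ s = -LaurentPolynomial.T (-(d : ℤ))) :
    QWeyl d q →ₐ[k] QWeyl d q :=
  GWA.lift ((coeff d q).comp ((laurentScale q).toAlgHom.comp LaurentPolynomial.invert.toAlgHom))
    (coeff d q r * y d q) (coeff d q s * x d q)
    (by
      rw [mul_assoc, ← mul_assoc (y d q), y_mul_coeff, mul_assoc, y_mul_x, ← map_mul, ← map_mul,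
        ← mul_assoc, hrs, AlgHom.comp_apply]
      exact congrArg _ (laurentScale_invert_shifted d q).symm)
    (by
      rw [mul_assoc, ← mul_assoc (x d q), x_mul_coeff, mul_assoc, x_mul_y, ← map_mul, ← map_mul,
        AlgHom.comp_apply]
      refine congrArg _ ?_
      have h1 := congrArg (laurentScale q) hrs
      rw [map_mul, ← laurentScale_mul, mul_inv_cancel, laurentScale_one] at h1
      have h2 := congrArg (laurentScale q) (laurentScale_invert_shifted d q)
      rw [map_mul, ← h1, invert_laurentScale, ← laurentScale_mul q q⁻¹, mul_inv_cancel,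
        laurentScale_one] at h2
      refine Eq.trans ?_ h2.symm
      ring)
    (fun p => by
      change _ * coeff d q (laurentScale q (LaurentPolynomial.invert p)) =
        coeff d q (laurentScale q (LaurentPolynomial.invert (laurentScale q p))) * _
      rw [mul_assoc, y_mul_coeff, invert_laurentScale, ← mul_assoc, ← mul_assoc, ← map_mul,
        ← map_mul, laurentScale_comm, mul_comm])
    (fun p => by
      change _ * coeff d q (laurentScale q (LaurentPolynomial.invert p)) =
        coeff d q (laurentScale q (LaurentPolynomial.invert ((laurentScale q).symm p))) * _
      rw [mul_assoc, x_mul_coeff, laurentScale_symm, invert_laurentScale, inv_inv, ← mul_assoc,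
        ← mul_assoc, ← map_mul, ← map_mul, mul_comm])

section Invert

variable {r s r' s' : k[T;T⁻¹]}
  (hrs : r * laurentScale q⁻¹ s = -LaurentPolynomial.T (-(d : ℤ)))
  (hrs' : r' * laurentScale q⁻¹ s' = -LaurentPolynomial.T (-(d : ℤ)))

theorem invertHom_coeff (p : k[T;T⁻¹]) :
    invertHom d q r s hrs (coeff d q p) =
      coeff d q (laurentScale q (LaurentPolynomial.invert p)) :=
  GWA.lift_coeff ..

theorem invertHom_x : invertHom d q r s hrs (x d q) = coeff d q r * y d q :=
  GWA.lift_x ..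

theorem invertHom_y : invertHom d q r s hrs (y d q) = coeff d q s * x d q :=
  GWA.lift_y ..

theorem invertHom_comp (hx : laurentScale q (LaurentPolynomial.invert r') * s = 1)
    (hy : laurentScale q (LaurentPolynomial.invert s') * r = 1) :
    (invertHom d q r s hrs).comp (invertHom d q r' s' hrs') = AlgHom.id k _ := by
  refine algHom_ext (fun m => ?_) ?_ ?_
  · rw [AlgHom.comp_apply, hPow, invertHom_coeff, invertHom_coeff, invert_laurentScale,
      ← laurentScale_mul, mul_inv_cancel, laurentScale_one, AlgHom.id_apply,
      LaurentPolynomial.invert_T, LaurentPolynomial.invert_T, neg_neg]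
  · rw [AlgHom.comp_apply, invertHom_x, map_mul, invertHom_coeff, invertHom_y, ← mul_assoc,
      ← map_mul, hx, map_one, one_mul, AlgHom.id_apply]
  · rw [AlgHom.comp_apply, invertHom_y, map_mul, invertHom_coeff, invertHom_x, ← mul_assoc,
      ← map_mul, hy, map_one, one_mul, AlgHom.id_apply]

end Invert

theorem exists_algEquiv_hPow_neg :
    ∃ g : QWeyl d q ≃ₐ[k] QWeyl d q, g (hPow d q 1) = ((q⁻¹ : kˣ) : k) • hPow d q (-1) := by
  -- The substitution `h ↦ q⁻¹ h⁻¹` is an involution. The map `x ↦ -h ^ (-d) y`, `y ↦ x` has inverse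
  -- `x ↦ y`, `y ↦ σ(-h ^ (-d)) x`.
  have hrs : -LaurentPolynomial.T (-(d : ℤ)) * laurentScale q⁻¹ (1 : k[T;T⁻¹]) =
      -LaurentPolynomial.T (-(d : ℤ)) := by rw [map_one, mul_one]
  have hrs' : (1 : k[T;T⁻¹]) * laurentScale q⁻¹ (laurentScale q (-LaurentPolynomial.T (-(d : ℤ)))) =
      -LaurentPolynomial.T (-(d : ℤ)) := by
    rw [one_mul, ← laurentScale_mul, inv_mul_cancel, laurentScale_one]
  have hT : (LaurentPolynomial.T (d : ℤ) * LaurentPolynomial.T (-(d : ℤ)) : k[T;T⁻¹]) = 1 := by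
    rw [← LaurentPolynomial.T_add, add_neg_cancel, LaurentPolynomial.T_zero]
  refine ⟨AlgEquiv.ofAlgHom (invertHom d q _ _ hrs) (invertHom d q _ _ hrs')
    (invertHom_comp d q hrs hrs' ?_ ?_) (invertHom_comp d q hrs' hrs ?_ ?_), ?_⟩
  · simp
  · rw [invert_laurentScale, ← laurentScale_mul, mul_inv_cancel, laurentScale_one, map_neg,
      LaurentPolynomial.invert_T, neg_neg, neg_mul_neg, hT]
  · rw [map_neg, LaurentPolynomial.invert_T, neg_neg, ← map_mul, neg_mul_neg, hT, map_one]
  · simp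
  · refine (invertHom_coeff d q hrs _).trans ?_
    rw [LaurentPolynomial.invert_T, laurentScale_T, map_smul, zpow_neg_one, hPow]

theorem exists_algEquiv_hPow_neg_of_pow_eq_one (c : kˣ) (hc : (c * q) ^ d = 1) :
    ∃ g : QWeyl d q ≃ₐ[k] QWeyl d q, g (hPow d q 1) = (c : k) • hPow d q (-1) := by
  obtain ⟨g, hg⟩ := exists_algEquiv_hPow_neg d q
  -- Scaling `h` by `(c q)⁻¹` multiplies `h⁻¹` by `c q`, which turns the factor `q⁻¹` into `c`.
  refine ⟨g.trans (scaleEquiv d q (c * q)⁻¹ (by rw [inv_pow, hc, inv_one])), ?_⟩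
  rw [AlgEquiv.trans_apply, hg, map_smul, scaleEquiv_hPow, smul_smul, ← Units.val_mul,
    zpow_neg_one, inv_inv, mul_comm c, inv_mul_cancel_left]

end QWeyl

namespace QWA

open SkewMonoidAlgebra ShiftGroup

variable {n d : ℕ} {q : kˣ}

/-! ### Tame automorphisms -/

theorem algEquiv_ext_tprod {φ ψ : QWA n d q ≃ₐ[k] QWA n d q}
    (h : ∀ a, φ (PiTensorProduct.tprod k a) = ψ (PiTensorProduct.tprod k a)) : φ = ψ :=
  AlgEquiv.coe_toAlgHom_injective (PiTensorProduct.algHom_ext_tprod h)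

theorem isQwaTame_permAlgEquiv [NeZero n] (w : Equiv.Perm (Fin n)) :
    IsQwaTame (PiTensorProduct.permAlgEquiv w : QWA n d q ≃ₐ[k] QWA n d q) :=
  Subgroup.subset_closure <| Or.inl <| Or.inr ⟨w, fun i =>
    ⟨PiTensorProduct.permAlgEquiv_singleAlgHom w i _,
      PiTensorProduct.permAlgEquiv_singleAlgHom w i _,
      PiTensorProduct.permAlgEquiv_singleAlgHom w i _⟩⟩

/-- The tensor product of automorphisms, as a homomorphism of groups. -/
noncomputable def mapMonoidHom :
    (Fin n → (QWeyl d q ≃ₐ[k] QWeyl d q)) →* (QWA n d q ≃ₐ[k] QWA n d q) where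
  toFun g := PiTensorProduct.mapAlgEquiv g
  map_one' := algEquiv_ext_tprod fun a => by simp
  map_mul' g g' := algEquiv_ext_tprod fun a => by simp

theorem mapMonoidHom_tprod (g : Fin n → (QWeyl d q ≃ₐ[k] QWeyl d q)) (a : Fin n → QWeyl d q) :
    mapMonoidHom g (PiTensorProduct.tprod k a) = PiTensorProduct.tprod k fun i => g i (a i) :=
  PiTensorProduct.mapAlgEquiv_tprod g a

/-- An automorphism of the `i`-th factor is conjugate, by the transposition of `0` and `i`, to one
of the factor `0`; products of these give all tensor products of automorphisms. -/
theorem isQwaTame_mapMonoidHom [NeZero n] (g : Fin n → (QWeyl d q ≃ₐ[k] QWeyl d q)) :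
    IsQwaTame (mapMonoidHom g) := by
  refine Subgroup.pi_mem_of_mulSingle_mem (H := (Subgroup.closure _).comap mapMonoidHom) g
    fun i => ?_
  rw [Subgroup.mem_comap]
  have h0 : IsFactorAut (mapMonoidHom (Pi.mulSingle 0 (g i)) : QWA n d q ≃ₐ[k] QWA n d q) := by
    refine ⟨g i, fun a => ?_⟩
    rw [mapMonoidHom_tprod]
    congr 1
    funext j
    rcases eq_or_ne j 0 with rfl | hj
    · simp
    · simp [hj]
  have heq : mapMonoidHom (Pi.mulSingle i (g i)) =
      PiTensorProduct.permAlgEquiv (Equiv.swap 0 i) * mapMonoidHom (Pi.mulSingle 0 (g i)) *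
        (PiTensorProduct.permAlgEquiv (Equiv.swap 0 i) : QWA n d q ≃ₐ[k] QWA n d q) := by
    refine algEquiv_ext_tprod fun a => ?_
    rw [AlgEquiv.mul_apply, AlgEquiv.mul_apply, PiTensorProduct.permAlgEquiv_tprod,
      mapMonoidHom_tprod, mapMonoidHom_tprod, PiTensorProduct.permAlgEquiv_tprod]
    congr 1
    funext j
    rw [Equiv.symm_swap, Equiv.swap_apply_self]
    by_cases hj : j = i
    · subst hj
      simp
    · have : Equiv.swap 0 i j ≠ 0 := fun e => hj (by
        rw [← Equiv.swap_apply_self 0 i j, e, Equiv.swap_apply_left])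
      rw [Pi.mulSingle_eq_of_ne hj, Pi.mulSingle_eq_of_ne this]
  rw [heq]
  exact mul_mem (mul_mem (isQwaTame_permAlgEquiv _) (Subgroup.subset_closure (Or.inl (Or.inl h0))))
    (isQwaTame_permAlgEquiv _)

theorem coeff_mul_right_cancel {z : QWA n d q} {γ : Fin n → ℤ} {c : AddMonoidAlgebra k (Fin n → ℤ)}
    (hc : c ≠ 0) (hz : embed n d q z = single (mk q γ) c) {r s : AddMonoidAlgebra k (Fin n → ℤ)}
    (h : coeff n d q r * z = coeff n d q s * z) : r = s := by
  have := congrArg (embed n d q) h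
  rw [map_mul, map_mul, embed_coeff, embed_coeff, hz, torus_single_mul_single,
    torus_single_mul_single, shift_zero] at this
  exact mul_right_cancel₀ hc (single_injective _ this)

/-- Fixing `h_i` forces `j = i` and positive sign in `exists_signed_index`, so `x_i` and `y_i` are
only multiplied by Laurent polynomials. -/
theorem isUnitAut_of_map_h (hd : d ≠ 0) (hq : q ^ 2 ≠ 1) {ψ : QWA n d q ≃ₐ[k] QWA n d q}
    (h : ∀ i, ψ (QWA.h n d q i) = QWA.h n d q i) : IsUnitAut ψ := by
  obtain ⟨μ, hμ⟩ := exists_map_single hd ψ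
  have hsingle (i : Fin n) : ψ (coeff n d q (AddMonoidAlgebra.single (Pi.single i 1) 1)) =
      coeff n d q (AddMonoidAlgebra.single (Pi.single i 1) 1) := by
    rw [coeff_single_single_one, h]
  have hxy (i : Fin n) : (∃ s, ψ (y n d q i) = coeff n d q s * y n d q i) ∧
      ∃ t, ψ (x n d q i) = coeff n d q t * x n d q i := by
    obtain ⟨j, ε, -, hμi, hy, hx⟩ := exists_signed_index hd hq hμ i
    obtain ⟨c, hc, hc'⟩ := hμ (Pi.single i 1)
    rw [hsingle, hμi] at hc'
    have hji := (single_left_injective one_ne_zero (coeff_injective hc')).1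
    have h1 : j = i := by
      by_contra hne
      have := congrFun hji i
      rw [Pi.single_eq_same, Pi.single_eq_of_ne (Ne.symm hne)] at this
      exact one_ne_zero this
    subst h1
    obtain rfl : 1 = ε := Pi.single_injective (M := fun _ : Fin n => ℤ) j hji
    rw [isHomogeneous_iff hd] at hx hy
    rw [xPow_single_neg_one] at hy
    rw [xPow_single_one] at hx
    exact ⟨hy, hx⟩
  choose hs ht using hxy
  choose s hs using hs
  choose t ht using ht
  -- Comparing `ψ(y_i) ψ(x_i)` with `h_i ^ d - 1` and cancelling shows that `t i` is a unit, with
  -- inverse `σ_i(s i)`.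
  have hst (i : Fin n) : s i * shift q (Pi.single i (-1)) (t i) = 1 := by
    have h1 := map_y_mul_x (hsingle i)
    have h2 := coeff_mul_xPow_mul_coeff_mul_xPow_neg (d := d) (q := q) (s i) (t i)
      (Pi.single i (-1))
    rw [← Pi.single_neg, neg_neg, xPow_single_neg_one, xPow_single_one, y_mul_x, ← map_mul] at h2
    rw [hs, ht, h2] at h1
    have h3 := coeff_injective h1
    rw [← AddMonoidAlgebra.single_pow, ← coeffAt_T_sub_one] at h3
    exact mul_eq_right₀ (coeffAt_T_sub_one_ne_zero hd i) |>.1 h3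
  have hshift (i : Fin n) (r : AddMonoidAlgebra k (Fin n → ℤ)) :
      shift q (Pi.single i 1) (shift q (Pi.single i (-1)) r) = r := by
    rw [← shift_add, ← Pi.single_add, add_neg_cancel, Pi.single_zero, shift_zero]
  have hts (i : Fin n) : t i * shift q (Pi.single i 1) (s i) = 1 := by
    have := congrArg (shift q (Pi.single i 1)) (hst i)
    rwa [map_mul, hshift, map_one, mul_comm] at this
  refine ⟨fun i => ⟨coeff n d q (t i), coeff n d q (shift q (Pi.single i 1) (s i)), ?_, ?_⟩, t,
    fun i => rfl, fun i l hl => ?_, fun i => ⟨h i, ht i, ?_⟩⟩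
  · rw [← map_mul, hts, map_one]
  · rw [← map_mul, mul_comm, hts, map_one]
  -- The compatibility of the units is the image under `ψ` of the commutation of `x_i` and `x_l`,
  -- after cancelling `x_l x_i`.
  · have hxx : x n d q i * x n d q l = x n d q l * x n d q i :=
      PiTensorProduct.commute_singleAlgHom hl.symm _ _
    have hmul (i l : Fin n) : ψ (x n d q i) * ψ (x n d q l) =
        coeff n d q (t i * scaleAt q i (t l)) * (x n d q i * x n d q l) := by
      rw [ht, ht, mul_assoc, ← mul_assoc (x n d q i), ← xPow_single_one, xPow_mul_coeff,
        scaleAt_eq_shift, map_mul]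
      simp only [mul_assoc]
    have h1 := congrArg ψ hxx
    rw [map_mul, map_mul, hmul, hmul, hxx] at h1
    refine coeff_mul_right_cancel (z := x n d q l * x n d q i)
      (γ := Pi.single l 1 + Pi.single i 1) one_ne_zero ?_ h1
    rw [map_mul, x, x, embed_inFactor, embed_inFactor, embedFactor_x, embedFactor_x,
      torus_single_mul_single, map_one, mul_one]
  · rw [hs]
    refine Eq.symm ?_
    change y n d q i * coeff n d q (shift q (Pi.single i 1) (s i)) = _
    rw [← xPow_single_neg_one, xPow_mul_coeff, ← shift_add, ← Pi.single_add, neg_add_cancel,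
      Pi.single_zero, shift_zero]

theorem coeff_single_single (i : Fin n) (m : ℤ) (c : k) :
    coeff n d q (AddMonoidAlgebra.single (Pi.single i m) c) =
      inFactor n d q i (c • QWeyl.hPow d q m) := by
  rw [QWeyl.hPow, ← map_smul, inFactor_coeff, map_smul, coeffAt_T, AddMonoidAlgebra.smul_single,
    smul_eq_mul, mul_one]

/-- Every automorphism of `A(n, d, (q, …, q))` is tame if `q ^ 2 ≠ 1`. -/
theorem isQwaTame [NeZero n] (hd : d ≠ 0) (hq : q ^ 2 ≠ 1) (ψ : QWA n d q ≃ₐ[k] QWA n d q) :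
    IsQwaTame ψ := by
  obtain ⟨μ, hμ⟩ := exists_map_single hd ψ
  obtain ⟨ν, hν⟩ := exists_map_single hd ψ.symm
  have hνμ := exponents_comp hμ hν ψ.symm_apply_apply
  choose w ε hε hμw hy hx using exists_signed_index hd hq hμ
  -- If `w i = w i'`, then `e_i` and `e_i'` are both, up to sign, the vector `ν e_{w i}`, so they
  -- cannot be distinct.
  have hw : Function.Injective w := by
    intro i i' hii
    have h1 : Pi.single i 1 = ε i • ν (Pi.single (w i) 1) := by
      rw [← map_zsmul, ← Pi.single_smul, smul_eq_mul, mul_one, ← hμw, hνμ]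
    have h2 : Pi.single i' 1 = ε i' • ν (Pi.single (w i) 1) := by
      rw [← map_zsmul, ← Pi.single_smul, smul_eq_mul, mul_one, hii, ← hμw, hνμ]
    by_contra hne
    have h3 : ν (Pi.single (w i) 1) i = 0 := by
      have := congrFun h2 i
      rw [Pi.single_eq_of_ne hne, Pi.smul_apply, smul_eq_mul, eq_comm, mul_eq_zero] at this
      refine this.resolve_left ?_
      rcases hε i' with h | h <;> rw [h] <;> decide
    have := congrFun h1 i
    rw [Pi.single_eq_same, Pi.smul_apply, h3, smul_zero] at this
    exact one_ne_zero this
  -- The constraint on the scalar, `c ^ d = 1` or `(c q) ^ d = 1` according to the sign, is exactly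
  -- the one under which the corresponding one-factor automorphism exists.
  have hfac (i : Fin n) : ∃ g : QWeyl d q ≃ₐ[k] QWeyl d q,
      ψ (h n d q i) = inFactor n d q (w i) (g (QWeyl.hPow d q 1)) := by
    obtain ⟨c, hc, hψ⟩ := hμ (Pi.single i 1)
    rw [hμw] at hψ
    have hy := hy i
    have hx := hx i
    rcases hε i with he | he
    · rw [he] at hψ hx hy
      refine ⟨QWeyl.scaleEquiv d q (Units.mk0 c hc)
        (Units.ext (by simpa using pow_eq_one_of_map_h hd hψ hy hx)), ?_⟩
      rw [← coeff_single_single_one, hψ, coeff_single_single, QWeyl.scaleEquiv_hPow, zpow_one,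
        Units.val_mk0]
    · rw [he] at hψ hx hy
      rw [neg_neg] at hy
      obtain ⟨g, hg⟩ := QWeyl.exists_algEquiv_hPow_neg_of_pow_eq_one d q (Units.mk0 c hc)
        (Units.ext (by simpa using pow_eq_one_of_map_h_inv hd hψ hy hx))
      refine ⟨g, ?_⟩
      rw [← coeff_single_single_one, hψ, coeff_single_single, hg, Units.val_mk0]
  choose g hg using hfac
  let σ : Equiv.Perm (Fin n) := Equiv.ofBijective w (Finite.injective_iff_bijective.1 hw)
  let G : QWA n d q ≃ₐ[k] QWA n d q := PiTensorProduct.permAlgEquiv σ * mapMonoidHom g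
  have hG : IsQwaTame G := mul_mem (isQwaTame_permAlgEquiv σ) (isQwaTame_mapMonoidHom g)
  have hGh (i : Fin n) : G (h n d q i) = ψ (h n d q i) := by
    rw [hg]
    refine (congrArg (PiTensorProduct.permAlgEquiv σ)
      (PiTensorProduct.mapAlgEquiv_singleAlgHom g i (QWeyl.hPow d q 1))).trans ?_
    exact PiTensorProduct.permAlgEquiv_singleAlgHom σ i _
  have hunit : IsUnitAut (G⁻¹ * ψ) := isUnitAut_of_map_h hd hq fun i => by
    rw [AlgEquiv.mul_apply, ← hGh]
    exact G.symm_apply_apply _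
  have := mul_mem hG (Subgroup.subset_closure (Or.inr hunit))
  rwa [mul_inv_cancel_left] at this

end QWA

end QuantumWeylAnalogue

section WeylHayashi

variable {k : Type u} [Field k]

/-! ### The isomorphism with the generalized Weyl-Hayashi algebra -/

namespace Hayashi

variable (t : ℕ) (q : kˣ)

open HayashiGen

theorem Ω_mul_Ωinv : gen t q Ω * gen t q Ωinv = 1 := by
  simpa [gen] using RingQuot.mkAlgHom_rel k (HayashiRel.Ω_Ωinv (t := t) (q := q))

theorem Ωinv_mul_Ω : gen t q Ωinv * gen t q Ω = 1 := by
  simpa [gen] using RingQuot.mkAlgHom_rel k (HayashiRel.Ωinv_Ω (t := t) (q := q))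

theorem Ψ_mul_Ω : gen t q Ψ * gen t q Ω = (q : k) • (gen t q Ω * gen t q Ψ) := by
  simpa [gen] using RingQuot.mkAlgHom_rel k (HayashiRel.Ψ_Ω (t := t) (q := q))

theorem Ψdag_mul_Ω : gen t q Ψdag * gen t q Ω = (q : k)⁻¹ • (gen t q Ω * gen t q Ψdag) := by
  simpa [gen] using RingQuot.mkAlgHom_rel k (HayashiRel.Ψdag_Ω (t := t) (q := q))

theorem Ψ_mul_Ψdag : gen t q Ψ * gen t q Ψdag = ((q : k) ^ t - ((q : k) ^ t)⁻¹)⁻¹ •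
    ((q : k) ^ t • gen t q Ω ^ t - ((q : k) ^ t)⁻¹ • gen t q Ωinv ^ t) := by
  simpa [gen] using RingQuot.mkAlgHom_rel k (HayashiRel.Ψ_Ψdag (t := t) (q := q))

theorem Ψdag_mul_Ψ : gen t q Ψdag * gen t q Ψ = ((q : k) ^ t - ((q : k) ^ t)⁻¹)⁻¹ •
    (gen t q Ω ^ t - gen t q Ωinv ^ t) := by
  simpa [gen] using RingQuot.mkAlgHom_rel k (HayashiRel.Ψdag_Ψ (t := t) (q := q))

variable {t q} in
theorem algHom_ext {B : Type*} [Ring B] [Algebra k B] {f g : Hayashi t q →ₐ[k] B}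
    (h : ∀ w, f (gen t q w) = g (gen t q w)) : f = g := by
  apply RingQuot.ringQuot_ext'
  apply FreeAlgebra.hom_ext
  funext w
  exact h w

/-- The homomorphism to the quantum Weyl analogue algebra. -/
noncomputable def toQWeyl : Hayashi t q →ₐ[k] QWeyl (2 * t) q :=
  RingQuot.liftAlgHom k
    ⟨FreeAlgebra.lift k fun w => match w with
      | Ω => QWeyl.hPow (2 * t) q 1
      | Ωinv => QWeyl.hPow (2 * t) q (-1)
      | Ψ => QWeyl.x (2 * t) q
      | Ψdag => ((q : k) ^ t - ((q : k) ^ t)⁻¹)⁻¹ •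
          (QWeyl.hPow (2 * t) q (-(t : ℤ)) * QWeyl.y (2 * t) q), by
      have hq0 : ((q : k) ^ t) ≠ 0 := pow_ne_zero _ (Units.ne_zero q)
      have hT (m l : ℤ) : QWeyl.hPow (2 * t) q m * QWeyl.hPow (2 * t) q l =
          QWeyl.hPow (2 * t) q (m + l) := by
        rw [QWeyl.hPow, QWeyl.hPow, QWeyl.hPow, ← map_mul, LaurentPolynomial.T_add]
      have hpow (m : ℤ) : QWeyl.hPow (2 * t) q m ^ t = QWeyl.hPow (2 * t) q (t * m) := by
        rw [QWeyl.hPow, QWeyl.hPow, ← map_pow, LaurentPolynomial.T_pow]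
      have h0 : QWeyl.hPow (2 * t) q 0 = 1 := by
        rw [QWeyl.hPow, LaurentPolynomial.T_zero, map_one]
      have hx (m : ℤ) : QWeyl.x (2 * t) q * QWeyl.hPow (2 * t) q m =
          ((q ^ m : kˣ) : k) • (QWeyl.hPow (2 * t) q m * QWeyl.x (2 * t) q) := by
        rw [QWeyl.hPow, QWeyl.x_mul_coeff, laurentScale_T, map_smul, smul_mul_assoc]
      have hy (m : ℤ) : QWeyl.y (2 * t) q * QWeyl.hPow (2 * t) q m =
          ((q⁻¹ ^ m : kˣ) : k) • (QWeyl.hPow (2 * t) q m * QWeyl.y (2 * t) q) := by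
        rw [QWeyl.hPow, QWeyl.y_mul_coeff, laurentScale_T, map_smul, smul_mul_assoc]
      have hyx : QWeyl.y (2 * t) q * QWeyl.x (2 * t) q =
          QWeyl.hPow (2 * t) q ((2 * t : ℕ) : ℤ) - 1 := by
        rw [QWeyl.y_mul_x, map_sub, map_one, QWeyl.hPow]
      have hxy : QWeyl.x (2 * t) q * QWeyl.y (2 * t) q =
          ((q : k) ^ t * (q : k) ^ t) • QWeyl.hPow (2 * t) q ((2 * t : ℕ) : ℤ) - 1 := by
        rw [QWeyl.x_mul_y, map_sub, map_sub, map_one, map_one, laurentScale_T, map_smul,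
          QWeyl.hPow, zpow_natCast, Units.val_pow_eq_pow_val, two_mul, pow_add]
      have e1 : -(t : ℤ) + ((2 * t : ℕ) : ℤ) = t := by push_cast; ring
      intro u v h
      cases h with
      | Ω_Ωinv => simp [hT, h0]
      | Ωinv_Ω => simp [hT, h0]
      | Ψ_Ω => simpa using hx 1
      | Ψdag_Ω =>
        have := hy 1
        simp only [zpow_one, Units.val_inv_eq_inv_val] at this
        simp only [map_mul, map_smul, FreeAlgebra.lift_ι_apply]
        rw [smul_mul_assoc, mul_assoc, this, mul_smul_comm, ← mul_assoc, hT, mul_smul_comm,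
          ← mul_assoc, hT, add_comm, smul_comm]
      | Ψ_Ψdag =>
        simp only [map_mul, map_smul, map_sub, map_pow, FreeAlgebra.lift_ι_apply]
        -- Moving `x` past `h ^ (-t)` contributes `q ^ (-t)`, and `q ^ (-t) h ^ (-t) (q ^ (2 t) h ^
        -- (2 t) - 1) = q ^ t h ^ t - q ^ (-t) h ^ (-t)`.
        rw [mul_smul_comm, ← mul_assoc, hx, smul_mul_assoc, mul_assoc, hxy, mul_sub, mul_smul_comm,
          hT, e1, mul_one, hpow, hpow, mul_one, mul_neg_one, zpow_neg, zpow_natCast,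
          Units.val_inv_eq_inv_val, Units.val_pow_eq_pow_val, smul_sub, smul_smul,
          inv_mul_cancel_left₀ hq0]
      | Ψdag_Ψ =>
        simp only [map_mul, map_smul, map_sub, map_pow, FreeAlgebra.lift_ι_apply]
        rw [smul_mul_assoc, mul_assoc, hyx, mul_sub, hT, e1, mul_one, hpow, hpow, mul_one,
          mul_neg_one]⟩

theorem toQWeyl_Ω : toQWeyl t q (gen t q Ω) = QWeyl.hPow (2 * t) q 1 := by
  simp [toQWeyl, gen]

theorem toQWeyl_Ωinv : toQWeyl t q (gen t q Ωinv) = QWeyl.hPow (2 * t) q (-1) := by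
  simp [toQWeyl, gen]

theorem toQWeyl_Ψ : toQWeyl t q (gen t q Ψ) = QWeyl.x (2 * t) q := by
  simp [toQWeyl, gen]

theorem toQWeyl_Ψdag : toQWeyl t q (gen t q Ψdag) = ((q : k) ^ t - ((q : k) ^ t)⁻¹)⁻¹ •
    (QWeyl.hPow (2 * t) q (-(t : ℤ)) * QWeyl.y (2 * t) q) := by
  simp [toQWeyl, gen]

/-- The unit `Ω`. -/
noncomputable def Ωunit : (Hayashi t q)ˣ :=
  ⟨gen t q Ω, gen t q Ωinv, Ω_mul_Ωinv t q, Ωinv_mul_Ω t q⟩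

/-- The homomorphism from the Laurent polynomials with `h ↦ Ω`. -/
noncomputable def ofLaurent : k[T;T⁻¹] →ₐ[k] Hayashi t q :=
  AddMonoidAlgebra.lift k (Hayashi t q) ℤ
    ((Units.coeHom (Hayashi t q)).comp (zpowersHom (Hayashi t q)ˣ (Ωunit t q)))

theorem ofLaurent_T (m : ℤ) :
    ofLaurent t q (LaurentPolynomial.T m) = ((Ωunit t q ^ m : (Hayashi t q)ˣ) : Hayashi t q) := by
  refine (AddMonoidAlgebra.lift_single _ _ _).trans ?_
  rw [one_smul]
  rfl

/-- The hypothesis says that `z` semiconjugates the unit `Ω` to the unit `c Ω`, so it does the same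
for all integer powers. Commutation with `Ω⁻¹` thus follows from the relation for `Ω`. -/
theorem mul_Ω_zpow {z : Hayashi t q} {c : kˣ}
    (h : z * gen t q Ω = (c : k) • (gen t q Ω * z)) (m : ℤ) :
    z * ((Ωunit t q ^ m : (Hayashi t q)ˣ) : Hayashi t q) =
      ((c ^ m : kˣ) : k) • (((Ωunit t q ^ m : (Hayashi t q)ˣ) : Hayashi t q) * z) := by
  let v : (Hayashi t q)ˣ := Units.map (algebraMap k (Hayashi t q)).toMonoidHom c
  have hv : SemiconjBy z (Ωunit t q : Hayashi t q) ((v * Ωunit t q : (Hayashi t q)ˣ)) := by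
    refine h.trans ?_
    rw [Units.val_mul, Algebra.smul_def, ← mul_assoc]
    rfl
  have hcomm : Commute v (Ωunit t q) := Units.ext (Algebra.commutes (c : k) _)
  have := (hv.units_zpow_right m).eq
  rw [this, hcomm.mul_zpow, Units.val_mul, Algebra.smul_def, ← mul_assoc, ← map_zpow]
  rfl

theorem mul_ofLaurent {z : Hayashi t q} {c : kˣ}
    (h : z * gen t q Ω = (c : k) • (gen t q Ω * z)) (r : k[T;T⁻¹]) :
    z * ofLaurent t q r = ofLaurent t q (laurentScale c r) * z := by
  induction r using AddMonoidAlgebra.induction_linear with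
  | zero => simp
  | add r s hr hs => rw [map_add, mul_add, hr, hs, map_add, map_add, add_mul]
  | single m a =>
    have : AddMonoidAlgebra.single m a = a • (LaurentPolynomial.T m : k[T;T⁻¹]) := by
      rw [LaurentPolynomial.T, AddMonoidAlgebra.smul_single, smul_eq_mul, mul_one]
    rw [this, map_smul, map_smul, map_smul, laurentScale_T, map_smul, ofLaurent_T, mul_smul_comm,
      mul_Ω_zpow t q h, smul_mul_assoc, smul_mul_assoc]

variable {t q}

theorem sub_inv_ne_zero (hq : q ^ (2 * t) ≠ 1) : (q : k) ^ t - ((q : k) ^ t)⁻¹ ≠ 0 := by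
  intro h
  have h1 := congrArg (· * (q : k) ^ t) (sub_eq_zero.1 h)
  simp only [inv_mul_cancel₀ (pow_ne_zero t (Units.ne_zero q)), ← pow_add, ← two_mul] at h1
  exact hq (Units.ext (by simpa using h1))

variable (t q) in
theorem coe_Ωunit_zpow_natCast (m : ℕ) :
    ((Ωunit t q ^ (m : ℤ) : (Hayashi t q)ˣ) : Hayashi t q) = gen t q Ω ^ m := by
  rw [zpow_natCast]
  rfl

variable (t q) in
theorem Ω_pow_mul_Ωinv_pow : gen t q Ω ^ t * gen t q Ωinv ^ t = 1 := by
  have : Commute (gen t q Ω) (gen t q Ωinv) := (Ω_mul_Ωinv t q).trans (Ωinv_mul_Ω t q).symm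
  rw [← this.mul_pow, Ω_mul_Ωinv, one_pow]

variable (t q) in
theorem ofLaurent_T_two_mul : ofLaurent t q (LaurentPolynomial.T ((2 * t : ℕ) : ℤ)) =
    gen t q Ω ^ t * gen t q Ω ^ t := by
  rw [ofLaurent_T, coe_Ωunit_zpow_natCast, ← pow_add, ← two_mul]

variable (t q) in
theorem Ψdag_mul_ofLaurent (r : k[T;T⁻¹]) :
    gen t q Ψdag * ofLaurent t q r = ofLaurent t q (laurentScale q⁻¹ r) * gen t q Ψdag :=
  mul_ofLaurent t q (by rw [Ψdag_mul_Ω, Units.val_inv_eq_inv_val]) r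

/-- The homomorphism from the quantum Weyl analogue algebra. -/
noncomputable def ofQWeyl (hq : q ^ (2 * t) ≠ 1) : QWeyl (2 * t) q →ₐ[k] Hayashi t q :=
  GWA.lift (ofLaurent t q) (gen t q Ψ)
    -- This solves `Ψ† = (q ^ t - q ^ (-t))⁻¹ h ^ (-t) y` for `y`.
    (((q : k) ^ t - ((q : k) ^ t)⁻¹) • (gen t q Ω ^ t * gen t q Ψdag))
    (by
      rw [mul_smul_comm, ← mul_assoc, ← coe_Ωunit_zpow_natCast, mul_Ω_zpow t q (Ψ_mul_Ω t q),
        coe_Ωunit_zpow_natCast, smul_mul_assoc, mul_assoc, Ψ_mul_Ψdag, mul_smul_comm,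
        smul_comm _ _ (gen t q Ω ^ t * _), smul_smul, mul_inv_cancel₀ (sub_inv_ne_zero hq),
        one_smul, mul_sub, mul_smul_comm, mul_smul_comm, Ω_pow_mul_Ωinv_pow, map_sub, map_one,
        laurentScale_T, map_sub, map_smul, ofLaurent_T_two_mul, map_one, smul_sub, smul_smul,
        smul_smul, zpow_natCast, zpow_natCast, Units.val_pow_eq_pow_val, Units.val_pow_eq_pow_val,
        mul_inv_cancel₀ (pow_ne_zero t (Units.ne_zero q)), one_smul, ← pow_add, two_mul])
    (by
      rw [smul_mul_assoc, mul_assoc, Ψdag_mul_Ψ, mul_smul_comm, smul_smul,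
        mul_inv_cancel₀ (sub_inv_ne_zero hq), one_smul, mul_sub, Ω_pow_mul_Ωinv_pow, map_sub,
        map_one, ofLaurent_T_two_mul])
    (fun r => mul_ofLaurent t q (Ψ_mul_Ω t q) r)
    (fun r => by
      have hcomm : Commute (gen t q Ω ^ t) (ofLaurent t q (laurentScale q⁻¹ r)) := by
        rw [← coe_Ωunit_zpow_natCast, ← ofLaurent_T]
        exact (Commute.all _ _).map (ofLaurent t q)
      rw [smul_mul_assoc, mul_assoc, Ψdag_mul_ofLaurent, ← mul_assoc, hcomm.eq,
        laurentScale_symm, mul_smul_comm, mul_assoc])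

theorem ofQWeyl_hPow (hq : q ^ (2 * t) ≠ 1) (m : ℤ) :
    ofQWeyl hq (QWeyl.hPow (2 * t) q m) = ((Ωunit t q ^ m : (Hayashi t q)ˣ) : Hayashi t q) :=
  (GWA.lift_coeff ..).trans (ofLaurent_T t q m)

theorem ofQWeyl_x (hq : q ^ (2 * t) ≠ 1) : ofQWeyl hq (QWeyl.x (2 * t) q) = gen t q Ψ :=
  GWA.lift_x ..

theorem ofQWeyl_y (hq : q ^ (2 * t) ≠ 1) : ofQWeyl hq (QWeyl.y (2 * t) q) =
    ((q : k) ^ t - ((q : k) ^ t)⁻¹) • (gen t q Ω ^ t * gen t q Ψdag) :=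
  GWA.lift_y ..

theorem toQWeyl_Ωunit_zpow (m : ℤ) :
    toQWeyl t q ((Ωunit t q ^ m : (Hayashi t q)ˣ) : Hayashi t q) = QWeyl.hPow (2 * t) q m := by
  have hpow (e : ℤ) (m : ℕ) : QWeyl.hPow (2 * t) q e ^ m = QWeyl.hPow (2 * t) q (m * e) := by
    rw [QWeyl.hPow, QWeyl.hPow, ← map_pow, LaurentPolynomial.T_pow]
  obtain ⟨m, rfl | rfl⟩ := m.eq_nat_or_neg
  · rw [coe_Ωunit_zpow_natCast, map_pow, toQWeyl_Ω, hpow, mul_one]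
  · have h1 : ((Ωunit t q ^ (-(m : ℤ)) : (Hayashi t q)ˣ) : Hayashi t q) = gen t q Ωinv ^ m := by
      rw [zpow_neg, zpow_natCast, ← inv_pow]
      rfl
    rw [h1, map_pow, toQWeyl_Ωinv, hpow, mul_neg_one]

/-- The isomorphism with the quantum Weyl analogue algebra. -/
noncomputable def equivQWeyl (hq : q ^ (2 * t) ≠ 1) : Hayashi t q ≃ₐ[k] QWeyl (2 * t) q :=
  AlgEquiv.ofAlgHom (toQWeyl t q) (ofQWeyl hq)
    (QWeyl.algHom_ext
      (fun m => by
        rw [AlgHom.comp_apply, ofQWeyl_hPow, toQWeyl_Ωunit_zpow, AlgHom.id_apply])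
      (by rw [AlgHom.comp_apply, ofQWeyl_x, toQWeyl_Ψ, AlgHom.id_apply])
      (by
        have hT := toQWeyl_Ωunit_zpow (q := q) (t := t) t
        rw [coe_Ωunit_zpow_natCast] at hT
        rw [AlgHom.comp_apply, ofQWeyl_y, map_smul, map_mul, toQWeyl_Ψdag, AlgHom.id_apply,
          hT, mul_smul_comm, smul_smul,
          mul_inv_cancel₀ (sub_inv_ne_zero hq), one_smul, ← mul_assoc, QWeyl.hPow, QWeyl.hPow,
          ← map_mul, ← LaurentPolynomial.T_add, add_neg_cancel, LaurentPolynomial.T_zero, map_one,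
          one_mul]))
    (algHom_ext fun w => by
      rw [AlgHom.comp_apply, AlgHom.id_apply]
      cases w with
      | Ω => rw [toQWeyl_Ω, ofQWeyl_hPow, zpow_one]; rfl
      | Ωinv => rw [toQWeyl_Ωinv, ofQWeyl_hPow, zpow_neg_one]; rfl
      | Ψ => rw [toQWeyl_Ψ, ofQWeyl_x]
      | Ψdag =>
        have h1 :
            ((Ωunit t q ^ (-(t : ℤ)) : (Hayashi t q)ˣ) : Hayashi t q) * gen t q Ω ^ t = 1 := by
          rw [← coe_Ωunit_zpow_natCast, ← Units.val_mul, ← zpow_add,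
            neg_add_cancel, zpow_zero, Units.val_one]
        rw [toQWeyl_Ψdag, map_smul, map_mul, ofQWeyl_hPow, ofQWeyl_y, mul_smul_comm, smul_smul,
          inv_mul_cancel₀ (sub_inv_ne_zero hq), one_smul, ← mul_assoc, h1, one_mul])

end Hayashi

end WeylHayashi

theorem theorem1p2 {k : Type u} [Field k] (n : ℕ) [NeZero n] (t : ℕ) (ht : 0 < t)
    (q : kˣ) (hq : q ^ (2 * t) ≠ 1) :
    ∃ Θ : HayashiPow n t q ≃ₐ[k] QWA n (2 * t) q,
      HayashiPow.IsStandardIso Θ ∧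
        ∀ ψ : HayashiPow n t q ≃ₐ[k] HayashiPow n t q,
          QWA.IsQwaTame ((Θ.symm.trans ψ).trans Θ) := by
  -- The one-factor isomorphism is taken in every factor. Tameness applies to the conjugated
  -- automorphism because `q ^ 2 = 1` would give `q ^ (2 * t) = 1`.
  refine ⟨PiTensorProduct.mapAlgEquiv fun _ => Hayashi.equivQWeyl hq, fun i => ⟨?_, ?_, ?_⟩,
    fun ψ => QWA.isQwaTame (by omega) (fun h => hq (by rw [pow_mul, h, one_pow])) _⟩
  · exact (PiTensorProduct.mapAlgEquiv_singleAlgHom _ i _).trans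
      (congrArg _ (Hayashi.toQWeyl_Ω t q))
  · exact (PiTensorProduct.mapAlgEquiv_singleAlgHom _ i _).trans
      (congrArg _ (Hayashi.toQWeyl_Ψ t q))
  · refine ((PiTensorProduct.mapAlgEquiv_singleAlgHom _ i _).trans
      (congrArg _ (Hayashi.toQWeyl_Ψdag t q))).trans ?_
    change QWA.inFactor n (2 * t) q i _ = _
    rw [map_smul, map_mul, QWA.y]
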